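/- Let $X_{ij}$ ($i,j=1,2,\ldots$) be independent random variables, where $X_{ij}$, the $j$-th observation of alternative $i$, is normal with mean $\mu_i$ and variance $\sigma_i^2\ge 0$ (neither depends on $k$). Let $\bar X_i(n)=\frac1n\sum_{j=1}^n X_{ij}$. Suppose that alternative $1$ is a best one, i.e. $\mu_1\ge\mu_i$ for all $i$, and that $\sigma_i^2\le\bar\sigma^2$ for all $i$, where $0<\bar\sigma<\infty$. For each $k\ge 1$ consider the greedy procedure for the alternatives $1,\ldots,k$ with total budget $B=B_k\in\mathbb N$: take one observation from each of the $k$ alternatives; then, as long as fewer than $B$ observations have been taken, take the next observation from an alternative whose current sample mean is largest; finally select an alternative whose current sample mean is largest. Ties may be broken in any way. For a given $\delta>0$ let $\mathcal G=\mathcal G_k=\{i\le k:\mu_i>\mu_1-\delta\}$ be the set of good alternatives, and let $\mathrm{PGS}=\mathrm{PGS}_k$ be the probability that the selected alternative belongs to $\mathcal G_k$. For $x>0$ put \[ C(x)=\exp\Bigl(\sum_{n=1}^\infty \frac1n\,\Phi(-\sqrt n\,x)\Bigr), \] where $\Phi$ is the standard normal distribution function. Suppose that $\limsup_{k\to\infty}|\mathcal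 G_k|<\infty$, that $B_k/k\to c$ as $k\to\infty$ (for instance $B_k=ck$, or $B_k=\lfloor ck\rfloor$), and that $c>C(\delta/\bar\sigma)$. Then there is a $\delta_0\in(0,\delta)$ with $C\bigl((\delta-\delta_0)/\bar\sigma\bigr)=c$, and for every such $\delta_0$ \[ \liminf_{k\to\infty}\mathrm{PGS}_k\;\ge\;\limsup_{k\to\infty}\Pr\Bigl\{\exists\, i\in\mathcal G_k:\ \min_{n\ge1}\bar X_i(n)>\mu_1-\delta_0\Bigr\}\;\ge\;\Pr\Bigl\{\min_{n\ge1}\bar X_1(n)>\mu_1-\delta_0\Bigr\}. \] -/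

import Mathlib

open MeasureTheory ProbabilityTheory Filter Topology
open scoped NNReal ENNReal

noncomputable section

/-- The function `C(x) = exp (∑_{n ≥ 1} (1/n) Φ(-√n x))`, where `Φ` is the standard normal
distribution function. The series converges for every `x > 0`. -/
def crossingConst (x : ℝ) : ℝ :=
  Real.exp (∑' n : ℕ, (1 / ((n : ℝ) + 1)) * cdf (gaussianReal 0 1) (-(√((n : ℝ) + 1) * x)))

/-- The average of the first `n` observations `x 0, …, x (n - 1)`. -/
def sampleMean (x : ℕ → ℝ) (n : ℕ) : ℝ :=
  (∑ j ∈ Finset.range n, x j) / n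

/-- The minimum over `n ≥ 1` of the running average, taken as an infimum in the extended reals so
that it makes sense for every sequence. -/
def runningMin (x : ℕ → ℝ) : EReal :=
  ⨅ n : ℕ, ((sampleMean x (n + 1) : ℝ) : EReal)

/-- The alternatives are `0, …, k - 1`, each of which has received one observation at time `k`, and
the observation number `u + 1` (for `u ≥ k`) is taken from the alternative `s u`. This is the number
of observations of alternative `i` when `t ≥ k` observations have been taken in total. -/
def sampleSize (k : ℕ) (s : ℕ → ℕ) (t i : ℕ) : ℕ :=
  1 + ((Finset.Ico k t).filter (fun u => s u = i)).card

/-- `s` is the sequence of sample-best alternatives in a run of the greedy procedure with `k`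
alternatives and budget `B`, where `x i j` is the observation number `j + 1` of alternative `i`:
at each time `t = k, …, B` the alternative `s t` has the largest current sample mean (ties may be
broken in any way). For `t < B` it receives the next observation; `s B` is the alternative that the
procedure selects. -/
structure IsGreedyRun (k B : ℕ) (x : ℕ → ℕ → ℝ) (s : ℕ → ℕ) : Prop where
  lt : ∀ t, k ≤ t → t ≤ B → s t < k
  isMax : ∀ t, k ≤ t → t ≤ B → ∀ i < k,
    sampleMean (x i) (sampleSize k s t i) ≤ sampleMean (x (s t)) (sampleSize k s t (s t))

/-- The good alternatives among `0, …, k - 1`: those whose mean is larger than the mean of the best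
alternative, which is alternative `0`, minus `δ`. -/
def goodSet (μ : ℕ → ℝ) (δ : ℝ) (k : ℕ) : Finset ℕ :=
  (Finset.range k).filter (fun i => μ 0 - δ < μ i)

end

/-! Fix a level `L` slightly above `μ 0 - δ₀`, and suppose that some good alternative keeps all its
running averages above `L`. A bad alternative `j` whose average has fallen to `L` is then never
sample-best, so it receives at most `hit L` observations (`IsGreedyRun.sampleSize_le_hit`). These
hitting times are independent, have mean at most some `C < c` and uniformly bounded second moments,
so by Chebyshev (`tendsto_measure_le_sum`) the bad alternatives together leave more than any fixed
number of observations to the finitely many good ones, with probability tending to one.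

Hence some good alternative `i` is observed again while its running average is at its overall
minimum. At that moment every bad average is at most this minimum. Afterwards the average of `i`
lies strictly above it (or both equal `μ i`, a tie that almost surely does not occur), so no bad
alternative is ever sample-best again, and the selection is good
(`IsGreedyRun.mem_of_minAttainedAt`, `IsGreedyRun.mem_of_lt_budget`).

The constant comes from fluctuation theory. By time reversal, the expected time that a walk stays
positive is the expected number of ladder epochs, counting time zero. This is `1 / (1 - f)`, where
`f` is the probability of ever becoming positive. Sparre Andersen's identity `-log (1 - f) = ∑ P(S_n
> 0) / n` (`tsum_probPos_pow_div`), proved by a cyclic-rotation argument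
(`sum_ladderWeight_rotate`), then bounds the mean hitting time by `crossingConst`.

At `μ 0 - δ₀` itself this bound equals `c`. The strict inequality is gained by raising the level by
`1 / (r + 1)`, and `r → ∞` is taken at the end by continuity from below. -/

namespace RandomWalk

/-! ### Ladder epochs and cyclic rotations -/

noncomputable section

/-- The sum of the first `n` steps. -/
def partialSum (x : ℕ → ℝ) (n : ℕ) : ℝ := ∑ i ∈ Finset.range n, x i

/-- The time `n` is a strict ascending ladder epoch of the walk with steps `x`. -/
def IsLadder (x : ℕ → ℝ) (n : ℕ) : Prop := ∀ i < n, partialSum x i < partialSum x n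

/-- The number of ladder epochs in `(0, n]`. -/
def ladderCount (x : ℕ → ℝ) (n : ℕ) : ℕ := by
  classical exact ((Finset.Ioc 0 n).filter (IsLadder x)).card

/-- The reciprocal of the number of ladder epochs up to `n` if `n` is one of them, else zero. -/
def ladderWeight (n : ℕ) (x : ℕ → ℝ) : ℝ≥0∞ := by
  classical exact if IsLadder x n then (ladderCount x n : ℝ≥0∞)⁻¹ else 0

/-- The cyclic rotation by `p` of the first `n` natural numbers. -/
def rotate (n p i : ℕ) : ℕ := if i < n then (i + p) % n else i

end

lemma rotate_injective (n p : ℕ) : Function.Injective (rotate n p) := by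
  intro i j h
  unfold rotate at h
  split_ifs at h with h1 h2 h2
  · have : i ≡ j [MOD n] := Nat.ModEq.add_right_cancel' p h
    rwa [Nat.ModEq, Nat.mod_eq_of_lt h1, Nat.mod_eq_of_lt h2] at this
  · exact absurd (h ▸ Nat.mod_lt _ (by omega)) h2
  · exact absurd (h ▸ Nat.mod_lt _ (by omega)) h1
  · exact h

@[simp] lemma partialSum_zero (x : ℕ → ℝ) : partialSum x 0 = 0 := by simp [partialSum]

lemma partialSum_succ (x : ℕ → ℝ) (n : ℕ) : partialSum x (n + 1) = partialSum x n + x n := by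
  simp [partialSum, Finset.sum_range_succ]

lemma partialSum_congr {x y : ℕ → ℝ} {n : ℕ} (h : ∀ i < n, x i = y i) :
    partialSum x n = partialSum y n :=
  Finset.sum_congr rfl fun i hi => h i (Finset.mem_range.1 hi)

lemma partialSum_add (x : ℕ → ℝ) (m n : ℕ) :
    partialSum x (m + n) = partialSum x m + partialSum (fun i => x (m + i)) n := by
  simp [partialSum, Finset.sum_range_add]

/-! ### The cyclic lemma -/

section Cycle

variable {n : ℕ} {T : ℕ → ℝ}

/-- A record of a path with stationary increments of period `n`, looking back one period. -/
def IsRecord (n : ℕ) (T : ℕ → ℝ) (q : ℕ) : Prop := ∀ i, q ≤ i → i < q + n → T i < T (q + n)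

lemma isRecord_periodic (hT : ∀ i, T (i + n) = T i + T n) :
    Function.Periodic (IsRecord n T) n := by
  intro q
  apply propext
  constructor
  · intro h i h1 h2
    have := h (i + n) (by omega) (by omega)
    rw [hT i, hT (q + n)] at this
    linarith
  · intro h i h1 h2
    have := h (i - n) (by omega) (by omega)
    have e := hT (i - n)
    rw [Nat.sub_add_cancel (by omega)] at e
    rw [e, hT (q + n)]
    linarith

/-- The first maximiser `p` of `T` over one period works: a positive drift lifts `T (p + n)` above
the rest of that period, and the points that wrap around come before the first maximum. -/
lemma exists_isRecord (hn : 0 < n) (hT : ∀ i, T (i + n) = T i + T n)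
    (hpos : 0 < T n) : ∃ p < n, IsRecord n T p := by
  classical
  obtain ⟨a, ha, hmax⟩ := Finset.exists_max_image (Finset.range n) T ⟨0, by simpa using hn⟩
  have hex : ∃ p, p < n ∧ ∀ i < n, T i ≤ T p :=
    ⟨a, by simpa using ha, fun i hi => hmax i (by simpa using hi)⟩
  obtain ⟨h1, h2⟩ := Nat.find_spec hex
  set p := Nat.find hex
  refine ⟨p, h1, fun i hi1 hi2 => ?_⟩
  rw [hT]
  by_cases hin : i < n
  · have := h2 i hin; linarith
  · have e := hT (i - n)
    rw [Nat.sub_add_cancel (by omega)] at e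
    rw [e]
    have hlt : i - n < p := by omega
    have := Nat.find_min hex hlt
    push Not at this
    obtain ⟨l, hl, hl'⟩ := this (by omega)
    have := h2 l hl
    linarith

lemma pos_of_isRecord (hn : 0 < n) (hT : ∀ i, T (i + n) = T i + T n) {p : ℕ}
    (h : IsRecord n T p) : 0 < T n := by
  have := h p le_rfl (by omega)
  rw [hT] at this
  linarith

/-- `T (p + n)` dominates the whole period from `p`, so exceeding the path since `p` is enough to
exceed it over a full period. Thus the ladder epochs of the walk started at a record are exactly the
records of one period, and their number does not depend on `p`. -/
lemma isRecord_iff_of_isRecord (hT : ∀ i, T (i + n) = T i + T n) {p q : ℕ}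
    (hp : IsRecord n T p) (hq1 : p < q) (hq2 : q ≤ p + n) :
    (∀ i, p ≤ i → i < q → T i < T q) ↔ IsRecord n T q := by
  constructor
  · intro h i h1 h2
    rw [hT]
    have hpq := h p le_rfl hq1
    by_cases hin : i < p + n
    · have := hp i (by omega) hin
      rw [hT] at this
      linarith
    · have e := hT (i - n)
      rw [Nat.sub_add_cancel (by omega)] at e
      have := h (i - n) (by omega) (by omega)
      linarith
  · intro h i h1 h2
    have := h (i + n) (by omega) (by omega)
    rw [hT, hT] at this
    linarith

end Cycle

/-- Among the `n` cyclic rotations of the steps, those with a ladder epoch at `n` have weights that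
add up to one, provided that there are any, that is, if the total sum is positive. -/
theorem sum_ladderWeight_rotate (x : ℕ → ℝ) {n : ℕ} (hn : 0 < n) :
    ∑ p ∈ Finset.range n, ladderWeight n (x ∘ rotate n p) =
      Set.indicator {x | 0 < partialSum x n} 1 x := by
  classical
  set T : ℕ → ℝ := partialSum fun i => x (i % n) with hTdef
  have hTn : T n = partialSum x n :=
    partialSum_congr fun i hi => by rw [Nat.mod_eq_of_lt hi]
  have hT : ∀ i, T (i + n) = T i + T n := by
    intro i
    rw [add_comm i n, hTdef, partialSum_add, add_comm]
    congr 1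
    simp
  have hrot : ∀ p, ∀ m ≤ n, partialSum (x ∘ rotate n p) m = T (p + m) - T p := by
    intro p m hm
    rw [hTdef, partialSum_add, add_sub_cancel_left]
    refine partialSum_congr fun i hi => ?_
    simp [rotate, lt_of_lt_of_le hi hm, add_comm]
  have hlad : ∀ p, ∀ m ≤ n, IsLadder (x ∘ rotate n p) m ↔
      ∀ i, p ≤ i → i < p + m → T i < T (p + m) := by
    intro p m hm
    constructor
    · intro h i h1 h2
      have := h (i - p) (by omega)
      rw [hrot p _ (by omega), hrot p _ hm, Nat.add_sub_cancel' h1] at this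
      linarith
    · intro h i hi
      have := h (p + i) (by omega) (by omega)
      rw [hrot p _ (by omega), hrot p _ hm]
      linarith
  -- There are `K` records per period. A rotation has a ladder epoch at `n` exactly when it starts
  -- at a record, and its weight is then `1 / K`.
  set K := Nat.count (IsRecord n T) n with hK
  have hcount : ∀ p, IsRecord n T p → ladderCount (x ∘ rotate n p) n = K := by
    intro p hp
    rw [hK, ← Nat.filter_Ico_card_eq_of_periodic (p + 1) n _ (isRecord_periodic hT), ladderCount]
    refine Finset.card_bij (fun m _ => p + m) ?_ (fun _ _ _ _ h => by omega) ?_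
    · intro m hm
      rw [Finset.mem_filter, Finset.mem_Ioc] at hm
      rw [Finset.mem_filter, Finset.mem_Ico]
      refine ⟨by omega, ?_⟩
      rw [← isRecord_iff_of_isRecord hT hp (by omega) (by omega)]
      exact (hlad p m hm.1.2).1 hm.2
    · intro q hq
      rw [Finset.mem_filter, Finset.mem_Ico] at hq
      refine ⟨q - p, ?_, by omega⟩
      rw [Finset.mem_filter, Finset.mem_Ioc]
      refine ⟨by omega, (hlad p _ (by omega)).2 ?_⟩
      rw [Nat.add_sub_cancel' (by omega)]
      exact (isRecord_iff_of_isRecord hT hp (by omega) (by omega)).2 hq.2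
  have hweight : ∀ p, ladderWeight n (x ∘ rotate n p) =
      if IsRecord n T p then (K : ℝ≥0∞)⁻¹ else 0 := by
    intro p
    rw [ladderWeight]
    by_cases hp : IsRecord n T p
    · rw [if_pos hp, if_pos ((hlad p n le_rfl).2 hp), hcount p hp]
    · rw [if_neg hp, if_neg fun h => hp ((hlad p n le_rfl).1 h)]
  rw [Finset.sum_congr rfl fun p _ => hweight p, ← Finset.sum_filter, Finset.sum_const,
    ← Nat.count_eq_card_filter_range, ← hK, nsmul_eq_mul]
  by_cases hpos : 0 < partialSum x n
  · rw [Set.indicator_of_mem (by exact hpos)]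
    obtain ⟨p, hp, hrec⟩ := exists_isRecord hn hT (hTn ▸ hpos)
    have : K ≠ 0 := by
      rw [hK, Nat.count_eq_card_filter_range]
      exact Finset.card_ne_zero_of_mem (a := p) (by simp [hp, hrec])
    exact ENNReal.mul_inv_cancel (by simpa using this) (by simp)
  · rw [Set.indicator_of_notMem (by exact hpos)]
    have : K = 0 := by
      rw [hK, Nat.count_eq_card_filter_range, Finset.card_eq_zero, Finset.filter_eq_empty_iff]
      exact fun p _ hp => hpos (hTn ▸ pos_of_isRecord hn hT hp)
    simp [this]

/-! ### Decomposition of ladder epochs at the first passage -/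

open Measure

/-- The walk is first positive at time `m`. -/
def firstPos (m : ℕ) : Set (ℕ → ℝ) := {x | 0 < partialSum x m ∧ ∀ i < m, partialSum x i ≤ 0}

/-- The `r`-th ladder epoch is `n`. -/
def ladderAt (r n : ℕ) : Set (ℕ → ℝ) := {x | IsLadder x n ∧ ladderCount x n = r}

/-- There are at least `r` ladder epochs. -/
def ladderEvent (r : ℕ) : Set (ℕ → ℝ) := ⋃ n, ladderAt r n

@[fun_prop]
lemma measurable_partialSum (n : ℕ) : Measurable fun x => partialSum x n := by
  unfold partialSum
  fun_prop

lemma measurableSet_isLadder (n : ℕ) : MeasurableSet {x | IsLadder x n} := by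
  unfold IsLadder
  measurability

lemma measurable_ladderCount (n : ℕ) : Measurable fun x => ladderCount x n := by
  classical
  simp only [ladderCount, Finset.card_filter]
  exact Finset.measurable_sum _ fun i _ =>
    Measurable.ite (measurableSet_isLadder i) measurable_const measurable_const

lemma measurableSet_ladderAt (r n : ℕ) : MeasurableSet (ladderAt r n) :=
  (measurableSet_isLadder n).inter (measurable_ladderCount n (measurableSet_singleton r))

lemma measurableSet_ladderEvent (r : ℕ) : MeasurableSet (ladderEvent r) :=
  .iUnion fun n => measurableSet_ladderAt r n

lemma measurableSet_firstPos (m : ℕ) : MeasurableSet (firstPos m) := by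
  unfold firstPos
  measurability

lemma measurable_ladderWeight (n : ℕ) : Measurable (ladderWeight n) := by
  classical
  unfold ladderWeight
  refine Measurable.ite (measurableSet_isLadder n) ?_ measurable_const
  exact (measurable_from_nat.comp (measurable_ladderCount n) :
    Measurable ((fun k : ℕ => (k : ℝ≥0∞)⁻¹) ∘ fun x => ladderCount x n))

lemma disjoint_firstPos : Pairwise (Function.onFun Disjoint firstPos) := by
  intro a b hab
  rw [Function.onFun, Set.disjoint_left]
  intro x ha hb
  rcases lt_or_gt_of_ne hab with h | h
  · exact absurd ha.1 (not_lt.2 (hb.2 a h))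
  · exact absurd hb.1 (not_lt.2 (ha.2 b h))

lemma iUnion_firstPos : ⋃ m, firstPos m = {x | ∃ n, 0 < partialSum x n} := by
  classical
  ext x
  simp only [Set.mem_iUnion, Set.mem_ofPred_eq]
  constructor
  · rintro ⟨m, hm⟩
    exact ⟨m, hm.1⟩
  · intro h
    exact ⟨Nat.find h, Nat.find_spec h, fun i hi => not_lt.1 (Nat.find_min h hi)⟩

lemma ladderCount_lt {x : ℕ → ℝ} {a b : ℕ} (hab : a < b) (hb : IsLadder x b) :
    ladderCount x a < ladderCount x b := by
  classical
  refine Finset.card_lt_card ((Finset.ssubset_iff_of_subset ?_).2 ⟨b, ?_, ?_⟩)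
  · exact Finset.filter_subset_filter _ (Finset.Ioc_subset_Ioc_right hab.le)
  · simp [hb]; omega
  · simp; omega

lemma disjoint_ladderAt (r : ℕ) : Pairwise (Function.onFun Disjoint (ladderAt r)) := by
  intro a b hab
  rw [Function.onFun, Set.disjoint_left]
  intro x ha hb
  rcases lt_or_gt_of_ne hab with h | h
  · exact absurd (ladderCount_lt h hb.1) (by rw [ha.2, hb.2]; exact lt_irrefl _)
  · exact absurd (ladderCount_lt h ha.1) (by rw [ha.2, hb.2]; exact lt_irrefl _)

/-- Before `m` the walk is at most zero and at `m` it is positive, so only the walk restarted at `m`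
matters. -/
lemma isLadder_add_iff {x : ℕ → ℝ} {m : ℕ} (hm : x ∈ firstPos m) (j : ℕ) :
    IsLadder x (m + j) ↔ IsLadder (fun i => x (m + i)) j := by
  constructor
  · intro h i hi
    have := h (m + i) (by omega)
    rw [partialSum_add, partialSum_add] at this
    linarith
  · intro h i hi
    have h2 : ∀ l ≤ j, 0 ≤ partialSum (fun i => x (m + i)) j := by
      intro l _
      rcases Nat.eq_zero_or_pos j with rfl | hj
      · simp
      · simpa using (h 0 hj).le
    rw [partialSum_add]
    by_cases him : i < m
    · have := hm.1
      have := hm.2 i him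
      have := h2 0 (by omega)
      linarith
    · obtain ⟨l, rfl⟩ := Nat.exists_eq_add_of_le (not_lt.1 him)
      rw [partialSum_add]
      have := h l (by omega)
      linarith

lemma not_isLadder_of_lt {x : ℕ → ℝ} {m i : ℕ} (hm : x ∈ firstPos m) (h0 : 0 < i) (hi : i < m) :
    ¬ IsLadder x i := by
  intro h
  have := h 0 h0
  rw [partialSum_zero] at this
  exact absurd this (not_lt.2 (hm.2 i hi))

lemma firstPos_pos {x : ℕ → ℝ} {m : ℕ} (hm : x ∈ firstPos m) : 0 < m := by
  rcases Nat.eq_zero_or_pos m with rfl | h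
  · exact absurd hm.1 (by simp)
  · exact h

lemma ladderCount_add {x : ℕ → ℝ} {m : ℕ} (hm : x ∈ firstPos m) (j : ℕ) :
    ladderCount x (m + j) = ladderCount (fun i => x (m + i)) j + 1 := by
  classical
  have hm0 := firstPos_pos hm
  have hladm : IsLadder x m := by
    have := (isLadder_add_iff hm 0).2 (fun i hi => absurd hi (by omega))
    simpa using this
  have : (Finset.Ioc 0 (m + j)).filter (IsLadder x) =
      insert m (((Finset.Ioc 0 j).filter (IsLadder fun i => x (m + i))).map
        (addLeftEmbedding m)) := by
    ext q
    simp only [Finset.mem_filter, Finset.mem_Ioc, Finset.mem_insert, Finset.mem_map,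
      addLeftEmbedding_apply]
    constructor
    · rintro ⟨⟨h1, h2⟩, h3⟩
      rcases lt_trichotomy q m with h | h | h
      · exact absurd h3 (not_isLadder_of_lt hm h1 h)
      · exact Or.inl h
      · obtain ⟨l, rfl⟩ := Nat.exists_eq_add_of_le h.le
        exact Or.inr ⟨l, ⟨by omega, (isLadder_add_iff hm l).1 h3⟩, rfl⟩
    · rintro (rfl | ⟨l, ⟨h1, h2⟩, rfl⟩)
      · exact ⟨by omega, hladm⟩
      · exact ⟨by omega, (isLadder_add_iff hm l).2 h2⟩
  rw [ladderCount, this, Finset.card_insert_of_notMem, Finset.card_map, ladderCount]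
  simp

/-- The first ladder epoch is the first passage above zero; the remaining `r` belong to the
restarted walk. -/
lemma ladderEvent_succ (r : ℕ) : ladderEvent (r + 1) =
    ⋃ m, firstPos m ∩ (fun x i => x (m + i)) ⁻¹' ladderEvent r := by
  classical
  ext x
  simp only [ladderEvent, ladderAt, Set.mem_iUnion, Set.mem_ofPred_eq, Set.mem_inter_iff,
    Set.mem_preimage]
  constructor
  · rintro ⟨n, h1, h2⟩
    have hn : 0 < n := by
      rcases Nat.eq_zero_or_pos n with rfl | h
      · simp [ladderCount] at h2
      · exact h
    have hex : x ∈ {x | ∃ n, 0 < partialSum x n} := ⟨n, by simpa using h1 0 hn⟩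
    rw [← iUnion_firstPos, Set.mem_iUnion] at hex
    obtain ⟨m, hm⟩ := hex
    have hmn : m ≤ n := by
      by_contra h
      exact not_isLadder_of_lt hm hn (not_le.1 h) h1
    obtain ⟨j, rfl⟩ := Nat.exists_eq_add_of_le hmn
    refine ⟨m, hm, j, (isLadder_add_iff hm j).1 h1, ?_⟩
    rw [ladderCount_add hm] at h2
    omega
  · rintro ⟨m, hm, j, h1, h2⟩
    exact ⟨m + j, (isLadder_add_iff hm j).2 h1, by rw [ladderCount_add hm, h2]⟩

/-! ### Sparre Andersen's identity -/

section Measure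

variable (ν : Measure ℝ) [IsProbabilityMeasure ν]

/-- The law of the steps of a random walk: an independent sequence with common law `ν`. -/
noncomputable abbrev stepLaw : Measure (ℕ → ℝ) := infinitePi fun _ => ν

/-- The probability that the walk ever becomes positive. -/
noncomputable def probPos : ℝ≥0∞ := stepLaw ν {x | ∃ n, 0 < partialSum x n}

lemma measurePreserving_comp {e : ℕ → ℕ} (he : Function.Injective e) :
    MeasurePreserving (fun x : ℕ → ℝ => x ∘ e) (stepLaw ν) (stepLaw ν) :=
  ⟨by fun_prop, map_infinitePi_infinitePi_of_inj (P := fun _ : ℕ => ν) he⟩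

lemma stepLaw_inter_shift {A E : Set (ℕ → ℝ)} (m : ℕ) (hA : MeasurableSet A)
    (hE : MeasurableSet E) (hdep : ∀ x y : ℕ → ℝ, (∀ i < m, x i = y i) → (x ∈ A ↔ y ∈ A)) :
    stepLaw ν (A ∩ (fun x i => x (m + i)) ⁻¹' E) = stepLaw ν A * stepLaw ν E := by
  have hind : iIndepFun (fun (i : ℕ) (x : ℕ → ℝ) => x i) (stepLaw ν) :=
    iIndepFun_infinitePi (P := fun _ : ℕ => ν) (X := fun _ x => x) fun _ => measurable_id
  have h := indep_iSup_of_disjoint (S := Set.Iio m) (T := Set.Ici m)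
    (fun i => (measurable_pi_apply i).comap_le) hind.iIndep
    (Set.disjoint_left.2 fun i hi hi' => absurd (Set.mem_Iio.1 hi) (not_lt.2 hi'))
  rw [Indep_iff] at h
  have hcoord : ∀ S : Set ℕ, ∀ i ∈ S, Measurable[⨆ i ∈ S, MeasurableSpace.comap
      (fun x : ℕ → ℝ => x i) inferInstance] fun x : ℕ → ℝ => x i := fun S i hi =>
    Measurable.mono (comap_measurable _) (le_iSup₂_of_le i hi le_rfl) le_rfl
  have hshift : stepLaw ν ((fun x i => x (m + i)) ⁻¹' E) = stepLaw ν E :=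
    (measurePreserving_comp ν (e := fun i => m + i)
      (add_right_injective m)).measure_preimage hE.nullMeasurableSet
  rw [h A _ ?_ ?_, hshift]
  -- Truncation after `m` steps does not affect `A`, which makes `A` measurable for the first `m`
  -- coordinates.
  · have : A = (fun x i => if i < m then x i else 0) ⁻¹' A := by
      ext x
      exact hdep _ _ fun i hi => by simp [hi]
    rw [this]
    refine @measurable_pi_lambda _ _ _ (_) _ _ (fun i => ?_) _ hA
    by_cases hi : i < m
    · simpa [hi] using hcoord (Set.Iio m) i hi
    · simp only [hi, if_false]
      exact @measurable_const _ _ _ (_) _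
  · exact @measurable_pi_lambda _ _ _ (_) _ _
      (fun i => hcoord (Set.Ici m) (m + i) (by simp)) _ hE

/-- The walk renews itself at each ladder epoch, so each further epoch costs an independent factor
`probPos ν`. -/
lemma stepLaw_ladderEvent (r : ℕ) : stepLaw ν (ladderEvent r) = probPos ν ^ r := by
  induction r with
  | zero =>
    have : ladderEvent 0 = Set.univ := by
      refine Set.eq_univ_of_forall fun x => Set.mem_iUnion.2 ⟨0, fun i hi => absurd hi (by omega), ?_⟩
      simp [ladderCount]
    simp [this]
  | succ r ih =>
    have hshift : ∀ m : ℕ, Measurable fun (x : ℕ → ℝ) (i : ℕ) => x (m + i) := fun m => by fun_prop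
    rw [ladderEvent_succ, measure_iUnion]
    · rw [pow_succ', ← ih, probPos, ← iUnion_firstPos,
        measure_iUnion disjoint_firstPos measurableSet_firstPos, ← ENNReal.tsum_mul_right]
      refine tsum_congr fun m => stepLaw_inter_shift ν m (measurableSet_firstPos m)
        (measurableSet_ladderEvent r) fun x y h => ?_
      have : ∀ j ≤ m, partialSum x j = partialSum y j := fun j hj =>
        partialSum_congr fun i hi => h i (by omega)
      simp only [firstPos, Set.mem_ofPred_eq]
      rw [this m le_rfl]
      refine and_congr_right fun _ => forall₂_congr fun i hi => ?_
      rw [this i hi.le]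
    · intro a b hab
      exact (disjoint_firstPos hab).mono Set.inter_subset_left Set.inter_subset_left
    · exact fun m => (measurableSet_firstPos m).inter (hshift m (measurableSet_ladderEvent r))

lemma tsum_ladderAt (r : ℕ) : ∑' n, stepLaw ν (ladderAt r n) = probPos ν ^ r := by
  rw [← stepLaw_ladderEvent, ladderEvent,
    measure_iUnion (disjoint_ladderAt r) (measurableSet_ladderAt r)]

/-- The reversal of the first `n` natural numbers. -/
def reversal (n i : ℕ) : ℕ := if i < n then n - 1 - i else i

lemma reversal_injective (n : ℕ) : Function.Injective (reversal n) := by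
  intro i j h
  unfold reversal at h
  split_ifs at h <;> omega

lemma partialSum_reversal (x : ℕ → ℝ) {n m : ℕ} (hm : m ≤ n) :
    partialSum (x ∘ reversal n) m = partialSum x n - partialSum x (n - m) := by
  induction m with
  | zero => simp
  | succ m ih =>
    rw [partialSum_succ, ih (by omega)]
    have : n - m = n - (m + 1) + 1 := by omega
    rw [this, partialSum_succ]
    simp only [Function.comp_apply, reversal, if_pos (Nat.lt_of_succ_le hm)]
    rw [show n - 1 - m = n - (m + 1) by omega]
    ring

/-- Duality: reversing the first `n` steps preserves the law and turns `S_m` into `S_n - S_{n-m}`.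
-/
lemma stepLaw_isLadder (n : ℕ) : stepLaw ν {x | IsLadder x n} =
    stepLaw ν {x | ∀ m, 1 ≤ m → m ≤ n → 0 < partialSum x m} := by
  have hms : MeasurableSet {x : ℕ → ℝ | ∀ m, 1 ≤ m → m ≤ n → 0 < partialSum x m} := by
    measurability
  rw [← (measurePreserving_comp ν (reversal_injective n)).measure_preimage hms.nullMeasurableSet]
  congr 1
  ext x
  simp only [Set.mem_ofPred_eq, Set.mem_preimage]
  constructor
  · intro h m h1 h2
    rw [partialSum_reversal x h2]
    linarith [h (n - m) (by omega)]
  · intro h i hi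
    have := h (n - i) (by omega) (by omega)
    rw [partialSum_reversal x (by omega), show n - (n - i) = i by omega] at this
    linarith

/-- By duality the left side counts ladder epochs by time; the right side counts them by index. -/
lemma tsum_pos_eq : ∑' n, stepLaw ν {x | ∀ m, 1 ≤ m → m ≤ n → 0 < partialSum x m} =
    ∑' r, probPos ν ^ r := by
  have h : ∀ n, stepLaw ν {x | ∀ m, 1 ≤ m → m ≤ n → 0 < partialSum x m} =
      ∑' r, stepLaw ν (ladderAt r n) := by
    intro n
    rw [← stepLaw_isLadder, ← measure_iUnion]
    · congr 1
      ext x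
      simp [ladderAt]
    · intro a b hab
      rw [Function.onFun, Set.disjoint_left]
      exact fun x ha hb => hab (ha.2.symm.trans hb.2)
    · exact fun r => measurableSet_ladderAt r n
  simp_rw [h]
  rw [ENNReal.tsum_comm]
  exact tsum_congr fun r => tsum_ladderAt ν r

omit [IsProbabilityMeasure ν] in
lemma lintegral_ladderWeight {n : ℕ} (hn : 0 < n) : ∫⁻ x, ladderWeight n x ∂stepLaw ν =
    ∑' r : ℕ, ((r : ℝ≥0∞) + 1)⁻¹ * stepLaw ν (ladderAt (r + 1) n) := by
  have : ∀ x, ladderWeight n x =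
      ∑' r : ℕ, (ladderAt (r + 1) n).indicator (fun _ => ((r : ℝ≥0∞) + 1)⁻¹) x := by
    intro x
    rw [ladderWeight]
    split_ifs with h
    · have hc : 0 < ladderCount x n := lt_of_le_of_lt (Nat.zero_le _) (ladderCount_lt hn h)
      rw [tsum_eq_single (ladderCount x n - 1)]
      · rw [Set.indicator_of_mem]
        · congr 1
          exact_mod_cast (Nat.sub_add_cancel hc).symm
        · exact ⟨h, by omega⟩
      · intro r hr
        exact Set.indicator_of_notMem (fun h' => hr (by have := h'.2; omega)) _
    · symm
      rw [ENNReal.tsum_eq_zero]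
      exact fun r => Set.indicator_of_notMem (fun h' => h h'.1) _
  simp_rw [this]
  rw [lintegral_tsum fun r =>
    (measurable_const.indicator (measurableSet_ladderAt (r + 1) n)).aemeasurable]
  exact tsum_congr fun r => lintegral_indicator_const (measurableSet_ladderAt (r + 1) n) _

/-- Integrate `sum_ladderWeight_rotate`: all `n` rotations preserve the law, so they contribute
equally. -/
lemma stepLaw_partialSum_pos {n : ℕ} (hn : 0 < n) : stepLaw ν {x | 0 < partialSum x n} =
    n * ∫⁻ x, ladderWeight n x ∂stepLaw ν := by
  have hms : MeasurableSet {x : ℕ → ℝ | 0 < partialSum x n} := by measurability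
  rw [← lintegral_indicator_one hms, ← lintegral_congr fun x => sum_ladderWeight_rotate x hn,
    lintegral_finsetSum]
  · rw [Finset.sum_congr rfl fun p _ => (measurePreserving_comp ν
      (rotate_injective n p)).lintegral_comp (measurable_ladderWeight n)]
    simp
  · exact fun p _ => (measurable_ladderWeight n).comp (by fun_prop)

/-- **Sparre Andersen's identity** for the probability that a random walk becomes positive. -/
theorem tsum_probPos_pow_div : ∑' r : ℕ, ((r : ℝ≥0∞) + 1)⁻¹ * probPos ν ^ (r + 1) =
    ∑' n : ℕ, ((n : ℝ≥0∞) + 1)⁻¹ * stepLaw ν {x | 0 < partialSum x (n + 1)} := by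
  have h : ∀ n : ℕ, ((n : ℝ≥0∞) + 1)⁻¹ * stepLaw ν {x | 0 < partialSum x (n + 1)} =
      ∑' r : ℕ, ((r : ℝ≥0∞) + 1)⁻¹ * stepLaw ν (ladderAt (r + 1) (n + 1)) := by
    intro n
    rw [stepLaw_partialSum_pos ν n.succ_pos, lintegral_ladderWeight ν n.succ_pos, ← mul_assoc]
    rw [Nat.cast_succ, ENNReal.inv_mul_cancel (by simp) (by simp), one_mul]
  simp_rw [h]
  rw [ENNReal.tsum_comm]
  refine tsum_congr fun r => ?_
  rw [ENNReal.tsum_mul_left, ← tsum_ladderAt, tsum_eq_zero_add' ENNReal.summable]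
  have : ladderAt (r + 1) 0 = ∅ := by
    ext x
    simp [ladderAt, ladderCount]
  rw [this, measure_empty, zero_add]

lemma probPos_le_one : probPos ν ≤ 1 := prob_le_one

/-- A bound for the expected time of the first passage to `(-∞, 0]`. -/
theorem tsum_pos_le_exp {b : ℕ → ℝ} (hb : ∀ n, 0 ≤ b n)
    (hsum : Summable fun n : ℕ => 1 / ((n : ℝ) + 1) * b n)
    (hle : ∀ n, stepLaw ν {x | 0 < partialSum x (n + 1)} ≤ ENNReal.ofReal (b n)) :
    ∑' n, stepLaw ν {x | ∀ m, 1 ≤ m → m ≤ n → 0 < partialSum x m} ≤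
      ENNReal.ofReal (Real.exp (∑' n : ℕ, 1 / ((n : ℝ) + 1) * b n)) := by
  have hne : probPos ν ≠ ∞ := ne_top_of_le_ne_top ENNReal.one_ne_top (probPos_le_one ν)
  obtain ⟨f, hf⟩ : ∃ f : ℝ≥0, probPos ν = f := ⟨_, (ENNReal.coe_toNNReal hne).symm⟩
  have hcast : ∀ r : ℕ, ((r : ℝ≥0∞) + 1)⁻¹ = ENNReal.ofReal (1 / ((r : ℝ) + 1)) := by
    intro r
    rw [one_div, ENNReal.ofReal_inv_of_pos (by positivity), ENNReal.ofReal_add (by positivity)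
      zero_le_one]
    simp
  have hkey : ∑' r : ℕ, ENNReal.ofReal ((f : ℝ) ^ (r + 1) / ((r : ℝ) + 1)) ≤
      ENNReal.ofReal (∑' n : ℕ, 1 / ((n : ℝ) + 1) * b n) := by
    have h1 : ∀ r : ℕ, ENNReal.ofReal ((f : ℝ) ^ (r + 1) / ((r : ℝ) + 1)) =
        ((r : ℝ≥0∞) + 1)⁻¹ * probPos ν ^ (r + 1) := by
      intro r
      rw [hcast, hf, div_eq_mul_one_div, mul_comm, ENNReal.ofReal_mul (by positivity),
        ENNReal.ofReal_pow (by positivity), ENNReal.ofReal_coe_nnreal]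
    simp_rw [h1]
    rw [tsum_probPos_pow_div, ENNReal.ofReal_tsum_of_nonneg
      (fun n => mul_nonneg (by positivity) (hb n)) hsum]
    refine ENNReal.tsum_le_tsum fun n => ?_
    rw [ENNReal.ofReal_mul (by positivity), hcast]
    gcongr
    exact hle n
  have hterm : ∀ r : ℕ, 0 ≤ (f : ℝ) ^ (r + 1) / ((r : ℝ) + 1) := fun r => by positivity
  have hsummable : Summable fun r : ℕ => (f : ℝ) ^ (r + 1) / ((r : ℝ) + 1) := by
    have := ENNReal.summable_toReal (ne_top_of_le_ne_top ENNReal.ofReal_ne_top hkey)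
    refine this.congr fun r => ENNReal.toReal_ofReal (hterm r)
  -- If `f = 1`, the summable series just obtained would be the harmonic series.
  have hf1 : (f : ℝ) < 1 := by
    have hle1 : (f : ℝ) ≤ 1 := by
      have := probPos_le_one ν
      rw [hf] at this
      exact_mod_cast this
    refine lt_of_le_of_ne hle1 fun h => ?_
    rw [h] at hsummable
    simp only [one_pow] at hsummable
    refine Real.not_summable_one_div_natCast ((summable_nat_add_iff 1).1 ?_)
    simpa using hsummable
  have hlog := Real.hasSum_pow_div_log_of_abs_lt_one (x := (f : ℝ))
    (by rw [abs_of_nonneg (by positivity)]; exact hf1)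
  rw [← ENNReal.ofReal_tsum_of_nonneg hterm hsummable, hlog.tsum_eq,
    ENNReal.ofReal_le_ofReal_iff (tsum_nonneg fun n => mul_nonneg (by positivity) (hb n))] at hkey
  rw [tsum_pos_eq, hf, ENNReal.tsum_geometric]
  have : (1 - (f : ℝ≥0∞))⁻¹ = ENNReal.ofReal ((1 - (f : ℝ))⁻¹) := by
    rw [ENNReal.ofReal_inv_of_pos (by linarith), ENNReal.ofReal_sub _ (by positivity)]
    simp
  rw [this]
  refine ENNReal.ofReal_le_ofReal ?_
  rw [← Real.exp_log (x := (1 - (f : ℝ))⁻¹) (by simpa using hf1), Real.log_inv]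
  exact Real.exp_le_exp.2 hkey

/-- A random walk that is positive at each time with probability bounded below becomes positive
almost surely. -/
theorem ae_exists_partialSum_pos {a : ℝ≥0∞} (ha : a ≠ 0)
    (hle : ∀ n, a ≤ stepLaw ν {x | 0 < partialSum x (n + 1)}) :
    ∀ᵐ x ∂stepLaw ν, ∃ n, 0 < partialSum x n := by
  have hms : MeasurableSet {x : ℕ → ℝ | ∃ n, 0 < partialSum x n} := by measurability
  refine (prob_compl_eq_zero_iff hms).2 ?_
  change probPos ν = 1
  by_contra hne
  have hlt : probPos ν < 1 := lt_of_le_of_ne (probPos_le_one ν) hne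
  -- For `f < 1` this side of Sparre Andersen's identity is below a geometric series, while the
  -- other is at least `a` times the harmonic series.
  have hfin : ∑' r : ℕ, ((r : ℝ≥0∞) + 1)⁻¹ * probPos ν ^ (r + 1) ≠ ∞ := by
    refine ne_top_of_le_ne_top (b := (1 - probPos ν)⁻¹) ?_ ?_
    · simpa [tsub_eq_zero_iff_le] using hlt
    · rw [← ENNReal.tsum_geometric]
      refine ENNReal.tsum_le_tsum fun r => ?_
      calc ((r : ℝ≥0∞) + 1)⁻¹ * probPos ν ^ (r + 1)
          ≤ 1 * probPos ν ^ (r + 1) := by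
            gcongr
            simp
        _ ≤ probPos ν ^ r := by
            rw [one_mul]
            exact pow_le_pow_of_le_one zero_le (probPos_le_one ν) r.le_succ
  rw [tsum_probPos_pow_div] at hfin
  have hfin2 : ∑' n : ℕ, ((n : ℝ≥0∞) + 1)⁻¹ * a ≠ ∞ :=
    ne_top_of_le_ne_top hfin (ENNReal.tsum_le_tsum fun n => by gcongr; exact hle n)
  rw [ENNReal.tsum_mul_right] at hfin2
  have hfin3 : ∑' n : ℕ, ((n : ℝ≥0∞) + 1)⁻¹ ≠ ∞ := by
    intro h
    rw [h, ENNReal.top_mul ha] at hfin2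
    exact hfin2 rfl
  have := ENNReal.summable_toReal hfin3
  refine Real.not_summable_one_div_natCast ((summable_nat_add_iff 1).1 ?_)
  refine this.congr fun n => ?_
  rw [ENNReal.toReal_inv, ENNReal.toReal_add (by simp) (by simp)]
  simp

end Measure

end RandomWalk

/-! ### The normal distribution function -/

section NormalCDF

lemma continuous_cdf_of_nullSingletonClass (ρ : Measure ℝ) [IsProbabilityMeasure ρ]
    (h : ∀ a, ρ {a} = 0) : Continuous (cdf ρ) := by
  rw [continuous_iff_continuousAt]
  intro a
  rw [(monotone_cdf ρ).continuousAt_iff_leftLim_eq_rightLim, StieltjesFunction.rightLim_eq]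
  have h1 := StieltjesFunction.measure_singleton (cdf ρ) a
  rw [measure_cdf, h a] at h1
  have h2 := ENNReal.ofReal_eq_zero.1 h1.symm
  exact le_antisymm ((monotone_cdf ρ).leftLim_le le_rfl) (by linarith)

lemma continuous_cdf_stdGaussian : Continuous (cdf (gaussianReal 0 1)) := by
  have := nullSingletonClass_gaussianReal (μ := 0) (v := 1) one_ne_zero
  exact continuous_cdf_of_nullSingletonClass _ fun a => measure_singleton a

/-- On a flat stretch the Gaussian measure, hence also Lebesgue measure, would vanish. -/
lemma strictMono_cdf_stdGaussian : StrictMono (cdf (gaussianReal 0 1)) := by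
  intro a b hab
  by_contra h
  have h1 := StieltjesFunction.measure_Ioc (cdf (gaussianReal 0 1)) a b
  rw [measure_cdf, ENNReal.ofReal_eq_zero.2 (by linarith)] at h1
  have h2 := gaussianReal_absolutelyContinuous' 0 (v := 1) one_ne_zero h1
  rw [Real.volume_Ioc, ENNReal.ofReal_eq_zero] at h2
  linarith

lemma cdf_stdGaussian_pos (a : ℝ) : 0 < cdf (gaussianReal 0 1) a :=
  lt_of_le_of_lt (cdf_nonneg _ (a - 1)) (strictMono_cdf_stdGaussian (by linarith))

lemma cdf_stdGaussian_neg_le_exp {t : ℝ} (ht : 0 ≤ t) :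
    cdf (gaussianReal 0 1) (-t) ≤ Real.exp (-t ^ 2 / 2) := by
  rw [cdf_eq_real]
  have h := measure_le_le_exp_mul_mgf (μ := gaussianReal 0 1) (X := id) (-t) (t := -t)
    (by linarith) (by simpa using integrable_exp_mul_gaussianReal (-t))
  rw [mgf_id_gaussianReal, ← Real.exp_add] at h
  refine h.trans (Real.exp_le_exp.2 (le_of_eq ?_))
  simp
  ring

/-- Standardisation; writing the hypothesis without division lets it cover the degenerate case `w =
0`. -/
lemma gaussianReal_Ioi_zero_le {a t : ℝ} {w : ℝ≥0} (h : t * √w ≤ -a) :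
    gaussianReal a w (Set.Ioi 0) ≤ ENNReal.ofReal (cdf (gaussianReal 0 1) (-t)) := by
  rcases eq_or_ne w 0 with rfl | hw
  · have ha : a ≤ 0 := by simpa using h
    rw [gaussianReal_zero_var, Measure.dirac_apply' _ measurableSet_Ioi,
      Set.indicator_of_notMem (by simpa using ha)]
    exact zero_le
  · have h1 : gaussianReal a w =
        (gaussianReal 0 1).map fun z => a - √w * z := by
      have := gaussianReal_map_const_mul (μ := 0) (v := 1) (-√w)
      have h2 := gaussianReal_map_const_add (μ := 0) (v := w) a
      have hw' : NNReal.mk ((-√(w : ℝ)) ^ 2) (sq_nonneg _) * 1 = w := by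
        ext
        simp
      rw [mul_zero, hw'] at this
      rw [zero_add, ← this, Measure.map_map (by fun_prop) (by fun_prop)] at h2
      rw [← h2]
      congr 1
      ext z
      simp
      ring
    rw [h1, Measure.map_apply (by fun_prop) measurableSet_Ioi, ofReal_cdf]
    refine measure_mono fun z hz => ?_
    have hz' : 0 < a - √w * z := hz
    have hpos : 0 < √(w : ℝ) := Real.sqrt_pos.2 (by positivity)
    change z ≤ -t
    by_contra hlt
    push Not at hlt
    nlinarith

end NormalCDF

/-! ### Monotonicity, continuity and range of `crossingConst` -/

section CrossingConst

/-- The terms of the series in the definition of `crossingConst`, without the factor `1 / n`. -/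
noncomputable def normalTail (x : ℝ) (n : ℕ) : ℝ :=
  cdf (gaussianReal 0 1) (-(√((n : ℝ) + 1) * x))

lemma crossingConst_eq (x : ℝ) :
    crossingConst x = Real.exp (∑' n : ℕ, 1 / ((n : ℝ) + 1) * normalTail x n) := rfl

lemma normalTail_nonneg (x : ℝ) (n : ℕ) : 0 ≤ normalTail x n := cdf_nonneg _ _

lemma normalTail_le {x : ℝ} (hx : 0 < x) (n : ℕ) :
    normalTail x n ≤ Real.exp (-x ^ 2 / 2) ^ (n + 1) := by
  refine (cdf_stdGaussian_neg_le_exp (by positivity)).trans (le_of_eq ?_)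
  rw [← Real.exp_nat_mul, mul_pow, Real.sq_sqrt (by positivity)]
  congr 1
  push_cast
  ring

lemma exp_neg_sq_lt_one {x : ℝ} (hx : 0 < x) : Real.exp (-x ^ 2 / 2) < 1 := by
  rw [Real.exp_lt_one_iff]
  have : 0 < x ^ 2 := by positivity
  linarith

lemma strictAnti_normalTail (n : ℕ) : StrictAnti fun x => normalTail x n := fun a b hab => by
  refine strictMono_cdf_stdGaussian (neg_lt_neg ?_)
  have : (0 : ℝ) < √((n : ℝ) + 1) := by positivity
  gcongr

lemma crossingTerm_le {x : ℝ} (hx : 0 < x) (n : ℕ) :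
    1 / ((n : ℝ) + 1) * normalTail x n ≤ Real.exp (-x ^ 2 / 2) ^ (n + 1) := by
  refine le_trans ?_ (normalTail_le hx n)
  refine mul_le_of_le_one_left (normalTail_nonneg x n) ?_
  rw [div_le_one (by positivity)]
  linarith [(Nat.cast_nonneg n : (0 : ℝ) ≤ n)]

lemma crossingTerm_nonneg (x : ℝ) (n : ℕ) : 0 ≤ 1 / ((n : ℝ) + 1) * normalTail x n :=
  mul_nonneg (by positivity) (normalTail_nonneg x n)

lemma summable_crossingTerm {x : ℝ} (hx : 0 < x) :
    Summable fun n : ℕ => 1 / ((n : ℝ) + 1) * normalTail x n :=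
  .of_nonneg_of_le (crossingTerm_nonneg x) (crossingTerm_le hx)
    ((summable_nat_add_iff 1).2 (summable_geometric_of_lt_one (Real.exp_nonneg _)
      (exp_neg_sq_lt_one hx)))

lemma strictAntiOn_crossingConst : StrictAntiOn crossingConst (Set.Ioi 0) := by
  intro a ha b hb hab
  rw [crossingConst_eq, crossingConst_eq, Real.exp_lt_exp]
  refine Summable.tsum_lt_tsum (i := 0) (fun n => ?_) ?_ (summable_crossingTerm hb)
    (summable_crossingTerm ha)
  · exact mul_le_mul_of_nonneg_left (strictAnti_normalTail n hab).le (by positivity)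
  · exact mul_lt_mul_of_pos_left (strictAnti_normalTail 0 hab) (by positivity)

lemma continuousOn_crossingConst {a : ℝ} (ha : 0 < a) : ContinuousOn crossingConst (Set.Ici a) := by
  refine Real.continuous_exp.comp_continuousOn (continuousOn_tsum
    (u := fun n => Real.exp (-a ^ 2 / 2) ^ (n + 1)) (fun n => ?_) ?_ fun n x hx => ?_)
  · refine Continuous.continuousOn ?_
    exact continuous_const.mul (continuous_cdf_stdGaussian.comp (by fun_prop))
  · exact (summable_nat_add_iff 1).2 (summable_geometric_of_lt_one (Real.exp_nonneg _)
      (exp_neg_sq_lt_one ha))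
  · have hx' : a ≤ x := hx
    have := crossingTerm_nonneg x n
    change ‖1 / ((n : ℝ) + 1) * normalTail x n‖ ≤ _
    rw [Real.norm_of_nonneg this]
    refine (crossingTerm_le (ha.trans_le hx') n).trans ?_
    gcongr

lemma exists_lt_crossingConst (c : ℝ) : ∃ x₀ > 0, ∀ x, 0 < x → x ≤ x₀ → c < crossingConst x := by
  have hp := cdf_stdGaussian_pos (-1)
  obtain ⟨N, hN⟩ : ∃ N : ℕ, c ≤
      cdf (gaussianReal 0 1) (-1) * ∑ n ∈ Finset.range N, 1 / ((n : ℝ) + 1) := by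
    have := Real.tendsto_sum_range_one_div_nat_succ_atTop.const_mul_atTop hp
    exact (this.eventually_ge_atTop c).exists
  -- For such `x` the first `N` arguments of `Φ` are at least `-1`, so a partial harmonic sum times
  -- `Φ(-1)` is a lower bound.
  refine ⟨1 / √((N : ℝ) + 1), by positivity, fun x hx hxN => ?_⟩
  have h1 : cdf (gaussianReal 0 1) (-1) * ∑ n ∈ Finset.range N, 1 / ((n : ℝ) + 1) ≤
      ∑' n : ℕ, 1 / ((n : ℝ) + 1) * normalTail x n := by
    rw [Finset.mul_sum]
    refine le_trans (Finset.sum_le_sum fun n hn => ?_)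
      ((summable_crossingTerm hx).sum_le_tsum _ fun n _ => crossingTerm_nonneg x n)
    rw [mul_comm]
    refine mul_le_mul_of_nonneg_left (monotone_cdf _ (neg_le_neg ?_)) (by positivity)
    rw [Finset.mem_range] at hn
    calc √((n : ℝ) + 1) * x ≤ √((N : ℝ) + 1) * (1 / √((N : ℝ) + 1)) := by
          gcongr
      _ = 1 := by field_simp
  calc c ≤ _ := hN.trans h1
    _ < _ := by
      rw [crossingConst_eq]
      linarith [Real.add_one_le_exp (∑' n : ℕ, 1 / ((n : ℝ) + 1) * normalTail x n)]

lemma exists_crossingConst_eq {x₁ c : ℝ} (hx : 0 < x₁) (hc : crossingConst x₁ < c) :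
    ∃ x ∈ Set.Ioo 0 x₁, crossingConst x = c := by
  obtain ⟨x₀, h0, h⟩ := exists_lt_crossingConst c
  have hpos : 0 < min x₀ x₁ := lt_min h0 hx
  obtain ⟨y, hy, hyc⟩ := intermediate_value_Icc' (min_le_right x₀ x₁)
    ((continuousOn_crossingConst hpos).mono Set.Icc_subset_Ici_self)
    ⟨hc.le, (h _ hpos (min_le_left _ _)).le⟩
  refine ⟨y, ⟨hpos.trans_le hy.1, lt_of_le_of_ne hy.2 ?_⟩, hyc⟩
  rintro rfl
  exact hc.ne hyc

end CrossingConst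

/-! ### Gaussian walks: hitting times of the running average -/

namespace RandomWalk

lemma map_partialSum_gaussian (m : ℝ) (v : ℝ≥0) (n : ℕ) :
    (stepLaw (gaussianReal m v)).map (fun x => partialSum x n) = gaussianReal (n * m) (n * v) := by
  induction n with
  | zero => simp [gaussianReal_zero_var]
  | succ n ih =>
    have hind : iIndepFun (fun (i : ℕ) (x : ℕ → ℝ) => x i) (stepLaw (gaussianReal m v)) :=
      iIndepFun_infinitePi (P := fun _ : ℕ => gaussianReal m v) (X := fun _ x => x)
        fun _ => measurable_id
    have h2 := hind.indepFun_sum_range_succ (fun i => measurable_pi_apply i) n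
    have h3 : (∑ j ∈ Finset.range n, fun x : ℕ → ℝ => x j) = fun x => partialSum x n := by
      ext x
      simp [partialSum]
    rw [h3] at h2
    have h4 := gaussianReal_add_gaussianReal_of_indepFun h2 ih
      (Measure.infinitePi_map_eval (fun _ : ℕ => gaussianReal m v) n)
    have h5 : (fun x => partialSum x (n + 1)) =
        (fun x => partialSum x n) + fun x : ℕ → ℝ => x n := by
      ext x
      exact partialSum_succ x n
    rw [h5, h4]
    congr 1 <;> push_cast <;> ring

lemma stepLaw_gaussian_pos_le {m ε b : ℝ} {s : ℝ≥0} (hε : 0 < ε) (hb : 0 < b) (hm : m ≤ -ε)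
    (hs : (s : ℝ) ≤ b) (n : ℕ) :
    stepLaw (gaussianReal m (s ^ 2)) {x | 0 < partialSum x (n + 1)} ≤
      ENNReal.ofReal (normalTail (ε / b) n) := by
  have := map_partialSum_gaussian m (s ^ 2) (n + 1)
  change stepLaw (gaussianReal m (s ^ 2)) ((fun x => partialSum x (n + 1)) ⁻¹' Set.Ioi 0) ≤ _
  rw [← Measure.map_apply (measurable_partialSum _) measurableSet_Ioi, this]
  refine gaussianReal_Ioi_zero_le ?_
  push_cast
  rw [Real.sqrt_mul (by positivity), Real.sqrt_sq (by positivity)]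
  have h1 : √((n : ℝ) + 1) * √((n : ℝ) + 1) = n + 1 := Real.mul_self_sqrt (by positivity)
  calc √((n : ℝ) + 1) * (ε / b) * (√((n : ℝ) + 1) * s)
      = (√((n : ℝ) + 1) * √((n : ℝ) + 1)) * (ε * (s / b)) := by ring
    _ ≤ (n + 1) * (ε * 1) := by
        rw [h1]
        gcongr
        exact (div_le_one hb).2 hs
    _ ≤ -((n + 1) * m) := by nlinarith [(Nat.cast_nonneg n : (0 : ℝ) ≤ n)]

lemma sampleMean_eq (z : ℕ → ℝ) (n : ℕ) : sampleMean z n = partialSum z n / n := rfl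

@[fun_prop]
lemma measurable_sampleMean (n : ℕ) : Measurable fun z => sampleMean z n := by
  simp only [sampleMean_eq]
  fun_prop

lemma partialSum_sub_const (z : ℕ → ℝ) (a : ℝ) (n : ℕ) :
    partialSum (fun i => z i - a) n = partialSum z n - n * a := by
  simp [partialSum, Finset.sum_sub_distrib]

lemma partialSum_const_sub (z : ℕ → ℝ) (a : ℝ) (n : ℕ) :
    partialSum (fun i => a - z i) n = n * a - partialSum z n := by
  simp [partialSum, Finset.sum_sub_distrib]

lemma lt_sampleMean_iff (z : ℕ → ℝ) (a : ℝ) {n : ℕ} (hn : 1 ≤ n) :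
    a < sampleMean z n ↔ 0 < partialSum (fun i => z i - a) n := by
  have : (0 : ℝ) < n := by exact_mod_cast hn
  rw [sampleMean_eq, partialSum_sub_const, lt_div_iff₀ this, sub_pos, mul_comm]

lemma sampleMean_lt_iff (z : ℕ → ℝ) (a : ℝ) {n : ℕ} (hn : 1 ≤ n) :
    sampleMean z n < a ↔ 0 < partialSum (fun i => a - z i) n := by
  have : (0 : ℝ) < n := by exact_mod_cast hn
  rw [sampleMean_eq, partialSum_const_sub, div_lt_iff₀ this, sub_pos, mul_comm]

/-- The first time `n ≥ 1` at which the running average is at most `L`, or zero if there is none. -/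
noncomputable def hit (L : ℝ) (z : ℕ → ℝ) : ℕ := sInf {n | 1 ≤ n ∧ sampleMean z n ≤ L}

lemma lt_sampleMean_of_lt_hit {L : ℝ} {z : ℕ → ℝ} {m : ℕ} (h : m < hit L z) (hm : 1 ≤ m) :
    L < sampleMean z m := by
  have := Nat.notMem_of_lt_sInf h
  by_contra hle
  exact this ⟨hm, not_lt.1 hle⟩

lemma hit_spec {L : ℝ} {z : ℕ → ℝ} (h : ∃ n, 1 ≤ n ∧ sampleMean z n ≤ L) :
    1 ≤ hit L z ∧ sampleMean z (hit L z) ≤ L :=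
  Nat.sInf_mem (s := {n | 1 ≤ n ∧ sampleMean z n ≤ L}) h

@[fun_prop]
lemma measurable_hit (L : ℝ) : Measurable (hit L) := by
  refine measurable_of_Ioi fun n => ?_
  have : hit L ⁻¹' Set.Ioi n = {z | ∃ k, 1 ≤ k ∧ sampleMean z k ≤ L} ∩
      {z | ∀ k ≤ n, 1 ≤ k → L < sampleMean z k} := by
    ext z
    simp only [Set.mem_preimage, Set.mem_Ioi, Set.mem_inter_iff, Set.mem_ofPred_eq]
    constructor
    · intro h
      refine ⟨?_, fun k hk h1 => lt_sampleMean_of_lt_hit (hk.trans_lt h) h1⟩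
      -- The infimum of the empty set is zero, so `n < hit L z` already forces the level to be
      -- reached.
      by_contra hne
      have : {n | 1 ≤ n ∧ sampleMean z n ≤ L} = ∅ :=
        Set.eq_empty_of_forall_notMem fun k hk => hne ⟨k, hk⟩
      rw [hit, this, Nat.sInf_empty] at h
      omega
    · rintro ⟨h1, h2⟩
      by_contra hle
      exact absurd (hit_spec h1).2 (not_le.2 (h2 _ (not_lt.1 hle) (hit_spec h1).1))
  rw [this]
  refine MeasurableSet.inter ?_ ?_
  · measurability
  · measurability

lemma tsum_indicator_lt (f : ℕ → ℝ≥0∞) (N : ℕ) :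
    ∑' n, (if n < N then f n else 0) = ∑ n ∈ Finset.range N, f n := by
  rw [tsum_eq_sum (s := Finset.range N)]
  · exact Finset.sum_congr rfl fun n hn => if_pos (Finset.mem_range.1 hn)
  · exact fun n hn => if_neg fun h => hn (Finset.mem_range.2 h)

lemma lintegral_sum_range_hit (ρ : Measure (ℕ → ℝ)) (L : ℝ) (f : ℕ → ℝ≥0∞) :
    ∫⁻ z, ∑ n ∈ Finset.range (hit L z), f n ∂ρ = ∑' n, f n * ρ {z | n < hit L z} := by
  have hms : ∀ n, MeasurableSet {z | n < hit L z} := fun n =>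
    measurable_hit L measurableSet_Ioi
  have h : ∀ z, ∑ n ∈ Finset.range (hit L z), f n =
      ∑' n, {z | n < hit L z}.indicator (fun _ => f n) z := by
    intro z
    rw [← tsum_indicator_lt]
    simp only [Set.indicator_apply, Set.mem_ofPred_eq]
  simp_rw [h]
  rw [lintegral_tsum fun n => (measurable_const.indicator (hms n)).aemeasurable]
  exact tsum_congr fun n => lintegral_indicator_const (hms n) _

lemma stepLaw_map_sub_const (m a : ℝ) (v : ℝ≥0) :
    (stepLaw (gaussianReal m v)).map (fun z i => z i - a) = stepLaw (gaussianReal (m - a) v) := by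
  rw [stepLaw, Measure.infinitePi_map_pi (f := fun _ x => x - a) _ fun _ => by fun_prop]
  simp_rw [gaussianReal_map_sub_const]

lemma stepLaw_map_const_sub (m a : ℝ) (v : ℝ≥0) :
    (stepLaw (gaussianReal m v)).map (fun z i => a - z i) = stepLaw (gaussianReal (a - m) v) := by
  rw [stepLaw, Measure.infinitePi_map_pi (f := fun _ x => a - x) _ fun _ => by fun_prop]
  simp_rw [gaussianReal_map_const_sub]

section Hit

variable {m L ε b : ℝ} {s : ℝ≥0}

/-- Subtracting `L` from each observation turns averages above `L` into positive partial sums. -/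
lemma stepLaw_lt_hit_le (n : ℕ) : stepLaw (gaussianReal m (s ^ 2)) {z | n < hit L z} ≤
    stepLaw (gaussianReal (m - L) (s ^ 2)) {x | ∀ k, 1 ≤ k → k ≤ n → 0 < partialSum x k} := by
  rw [← stepLaw_map_sub_const, Measure.map_apply (by fun_prop) (by measurability)]
  refine measure_mono fun z (hz : n < hit L z) k h1 h2 => ?_
  exact (lt_sampleMean_iff z L h1).1 (lt_sampleMean_of_lt_hit (h2.trans_lt hz) h1)

/-- The expected hitting time is at most `crossingConst`. -/
lemma lintegral_hit_le (hε : 0 < ε) (hb : 0 < b) (hm : m - L ≤ -ε) (hs : (s : ℝ) ≤ b) :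
    ∫⁻ z, (hit L z : ℝ≥0∞) ∂stepLaw (gaussianReal m (s ^ 2)) ≤
      ENNReal.ofReal (crossingConst (ε / b)) := by
  have h : ∀ z, (hit L z : ℝ≥0∞) = ∑ n ∈ Finset.range (hit L z), (fun _ => 1) n := by simp
  simp_rw [h]
  rw [lintegral_sum_range_hit, crossingConst_eq]
  simp_rw [one_mul]
  exact (ENNReal.tsum_le_tsum fun n => stepLaw_lt_hit_le n).trans
    (tsum_pos_le_exp _ (normalTail_nonneg _) (summable_crossingTerm (by positivity))
      (stepLaw_gaussian_pos_le hε hb hm hs))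

lemma stepLaw_forall_pos_le (hε : 0 < ε) (hb : 0 < b) (hm : m ≤ -ε) (hs : (s : ℝ) ≤ b) (n : ℕ) :
    stepLaw (gaussianReal m (s ^ 2)) {x | ∀ k, 1 ≤ k → k ≤ n → 0 < partialSum x k} ≤
      ENNReal.ofReal (Real.exp (-(ε / b) ^ 2 / 2) ^ n) := by
  cases n with
  | zero => simpa using prob_le_one
  | succ n =>
    refine (measure_mono fun x hx => ?_).trans ((stepLaw_gaussian_pos_le hε hb hm hs n).trans
      (ENNReal.ofReal_le_ofReal (normalTail_le (by positivity) n)))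
    exact hx (n + 1) (by omega) le_rfl

/-- A bound for the second moment of the hitting time. -/
noncomputable def secondMomentBound (x : ℝ) : ℝ :=
  ∑' n : ℕ, (2 * (n : ℝ) + 1) * Real.exp (-x ^ 2 / 2) ^ n

lemma summable_secondMomentBound {x : ℝ} (hx : 0 < x) :
    Summable fun n : ℕ => (2 * (n : ℝ) + 1) * Real.exp (-x ^ 2 / 2) ^ n := by
  have hr : ‖Real.exp (-x ^ 2 / 2)‖ < 1 := by
    rw [Real.norm_of_nonneg (Real.exp_nonneg _)]
    exact exp_neg_sq_lt_one hx
  have h1 := (summable_pow_mul_geometric_of_norm_lt_one 1 hr).mul_left 2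
  have h2 := summable_pow_mul_geometric_of_norm_lt_one 0 hr
  refine (h1.add h2).congr fun n => ?_
  simp
  ring

/-- Write `N ^ 2` as the sum of the first `N` odd numbers and use the geometric tail of the hitting
time. The bound depends only on `ε / b`, so it is uniform over the bad alternatives. -/
lemma lintegral_hit_sq_le (hε : 0 < ε) (hb : 0 < b) (hm : m - L ≤ -ε) (hs : (s : ℝ) ≤ b) :
    ∫⁻ z, (hit L z : ℝ≥0∞) ^ 2 ∂stepLaw (gaussianReal m (s ^ 2)) ≤
      ENNReal.ofReal (secondMomentBound (ε / b)) := by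
  have hsq : ∀ N : ℕ, ((N : ℝ≥0∞)) ^ 2 = ∑ n ∈ Finset.range N, (2 * (n : ℝ≥0∞) + 1) := by
    intro N
    induction N with
    | zero => simp
    | succ N ih =>
      rw [Finset.sum_range_succ, ← ih]
      push_cast
      ring
  simp_rw [hsq]
  rw [lintegral_sum_range_hit, secondMomentBound, ENNReal.ofReal_tsum_of_nonneg
    (fun n => by positivity) (summable_secondMomentBound (by positivity))]
  refine ENNReal.tsum_le_tsum fun n => ?_
  rw [ENNReal.ofReal_mul (by positivity)]
  refine mul_le_mul' (le_of_eq ?_) ((stepLaw_lt_hit_le n).trans (stepLaw_forall_pos_le hε hb hm hs n))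
  rw [ENNReal.ofReal_add (by positivity) zero_le_one, ENNReal.ofReal_mul (by positivity)]
  simp

lemma ae_exists_sampleMean_le (hε : 0 < ε) (hb : 0 < b) (hm : m - L ≤ -ε) (hs : (s : ℝ) ≤ b) :
    ∀ᵐ z ∂stepLaw (gaussianReal m (s ^ 2)), ∃ n, 1 ≤ n ∧ sampleMean z n ≤ L := by
  rw [ae_iff, ← nonpos_iff_eq_zero]
  refine ge_of_tendsto' (x := atTop) (f := fun n : ℕ =>
    ENNReal.ofReal (Real.exp (-(ε / b) ^ 2 / 2) ^ n)) ?_ fun n => ?_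
  · have := tendsto_pow_atTop_nhds_zero_of_lt_one (Real.exp_nonneg _)
      (exp_neg_sq_lt_one (x := ε / b) (by positivity))
    simpa using ENNReal.tendsto_ofReal this
  · refine le_trans ?_ (stepLaw_forall_pos_le hε hb hm hs n)
    rw [← stepLaw_map_sub_const, Measure.map_apply (by fun_prop) (by measurability)]
    refine measure_mono fun z hz k h1 h2 => ?_
    refine (lt_sampleMean_iff z L h1).1 ?_
    by_contra hle
    exact hz ⟨k, h1, not_lt.1 hle⟩

end Hit

/-! ### Ties and minima of the running averages -/

lemma ae_sampleMean_ne {m a : ℝ} (v : ℝ≥0) (hma : m ≠ a) :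
    ∀ᵐ z ∂stepLaw (gaussianReal m v), ∀ n, 1 ≤ n → sampleMean z n ≠ a := by
  rw [ae_all_iff]
  intro n
  by_cases hn : 1 ≤ n
  · have hn0 : (n : ℝ) ≠ 0 := by positivity
    have h : gaussianReal (n * m) (n * v) {(n : ℝ) * a} = 0 := by
      rcases eq_or_ne v 0 with rfl | hv
      · rw [mul_zero, gaussianReal_zero_var, Measure.dirac_apply' _ (measurableSet_singleton _),
          Set.indicator_of_notMem]
        simpa [hn0] using hma
      · have := nullSingletonClass_gaussianReal (μ := n * m) (v := n * v)
          (mul_ne_zero (by exact_mod_cast (by omega : n ≠ 0)) hv)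
        exact measure_singleton _
    rw [← map_partialSum_gaussian, Measure.map_apply (measurable_partialSum n)
      (measurableSet_singleton _)] at h
    rw [ae_iff]
    refine measure_mono_null (fun z hz => ?_) h
    simp only [hn, ne_eq, forall_const, not_not, Set.mem_ofPred_eq, sampleMean_eq] at hz
    change partialSum z n = n * a
    rw [← hz]
    field_simp
  · exact ae_of_all _ fun z h => absurd h hn

lemma half_le_gaussianReal_Ioi (v : ℝ≥0) (hv : v ≠ 0) :
    (2 : ℝ≥0∞)⁻¹ ≤ gaussianReal 0 v (Set.Ioi 0) := by
  have := nullSingletonClass_gaussianReal (μ := 0) (v := v) hv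
  have hsymm : gaussianReal 0 v (Set.Iio 0) = gaussianReal 0 v (Set.Ioi 0) := by
    conv_lhs => rw [← neg_zero, ← gaussianReal_map_neg,
      Measure.map_apply measurable_neg measurableSet_Iio]
    congr 1
    ext x
    simp
  have h1 : (1 : ℝ≥0∞) ≤ 2 * gaussianReal 0 v (Set.Ioi 0) := by
    calc (1 : ℝ≥0∞) = gaussianReal 0 v Set.univ := measure_univ.symm
      _ = gaussianReal 0 v (Set.Iic 0 ∪ Set.Ioi 0) := by rw [Set.Iic_union_Ioi]
      _ ≤ gaussianReal 0 v (Set.Iic 0) + gaussianReal 0 v (Set.Ioi 0) := measure_union_le _ _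
      _ = 2 * gaussianReal 0 v (Set.Ioi 0) := by
        rw [← measure_congr Iio_ae_eq_Iic, hsymm, two_mul]
  rw [ENNReal.inv_le_iff_le_mul (by simp) (by simp)]
  exact h1

/-- The reflected, centred walk is positive at each time with probability at least one half, so
`ae_exists_partialSum_pos` applies. -/
lemma ae_exists_sampleMean_lt (m : ℝ) {v : ℝ≥0} (hv : v ≠ 0) :
    ∀ᵐ z ∂stepLaw (gaussianReal m v), ∃ n, 1 ≤ n ∧ sampleMean z n < m := by
  have h := ae_exists_partialSum_pos (gaussianReal 0 v) (a := 2⁻¹) (by simp) fun n => by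
    change _ ≤ stepLaw (gaussianReal 0 v) ((fun x => partialSum x (n + 1)) ⁻¹' Set.Ioi 0)
    rw [← Measure.map_apply (measurable_partialSum _) measurableSet_Ioi, map_partialSum_gaussian,
      mul_zero]
    exact half_le_gaussianReal_Ioi _ (mul_ne_zero (by exact_mod_cast n.succ_ne_zero) hv)
  have hmap := stepLaw_map_const_sub m m v
  rw [sub_self] at hmap
  rw [← hmap] at h
  filter_upwards [ae_of_ae_map (Measurable.aemeasurable (by fun_prop)) h] with z ⟨n, hn⟩
  have h1 : 1 ≤ n := by
    rcases Nat.eq_zero_or_pos n with rfl | h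
    · simp at hn
    · exact h
  exact ⟨n, h1, (sampleMean_lt_iff z m h1).2 hn⟩

lemma ae_tendsto_sampleMean (m : ℝ) (v : ℝ≥0) :
    ∀ᵐ z ∂stepLaw (gaussianReal m v), Tendsto (sampleMean z) atTop (𝓝 m) := by
  have hind : iIndepFun (fun (i : ℕ) (x : ℕ → ℝ) => x i) (stepLaw (gaussianReal m v)) :=
    iIndepFun_infinitePi (P := fun _ : ℕ => gaussianReal m v) (X := fun _ x => x)
      fun _ => measurable_id
  have hmap : ∀ i : ℕ, (stepLaw (gaussianReal m v)).map (fun x => x i) = gaussianReal m v :=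
    fun i => Measure.infinitePi_map_eval (fun _ : ℕ => gaussianReal m v) i
  have hint : Integrable (fun x : ℝ => x) ((stepLaw (gaussianReal m v)).map fun x => x 0) := by
    rw [hmap]
    exact (memLp_id_gaussianReal 1).integrable (by simp)
  have h := strong_law_ae_real (μ := stepLaw (gaussianReal m v)) (fun (i : ℕ) (x : ℕ → ℝ) => x i)
    (hint.comp_measurable (by fun_prop)) (fun i j hij => hind.indepFun hij)
    (fun i => ⟨(measurable_pi_apply i).aemeasurable, (measurable_pi_apply 0).aemeasurable,
      by rw [hmap, hmap]⟩)
  have hE : ∫ x, x 0 ∂stepLaw (gaussianReal m v) = m := by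
    rw [← integral_map (φ := fun x : ℕ → ℝ => x 0) (f := fun y => y)
      (measurable_pi_apply 0).aemeasurable (by fun_prop),
      hmap, integral_id_gaussianReal]
  rw [hE] at h
  exact h

/-- The running averages `sampleMean z n`, `n ≥ 1`, have a minimum at `n`, which either equals `m`
or is not attained later. -/
def MinAttainedAt (m : ℝ) (z : ℕ → ℝ) (n : ℕ) : Prop :=
  1 ≤ n ∧ (∀ k, 1 ≤ k → sampleMean z n ≤ sampleMean z k) ∧
    (sampleMean z n = m ∨ ∀ k, n < k → sampleMean z n < sampleMean z k)

/-- A value below the limit leaves only finitely many candidates for the minimum; the last minimiser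
is taken to make later values strictly larger. -/
lemma exists_last_min {a : ℕ → ℝ} {m : ℝ} (ha : Tendsto a atTop (𝓝 m))
    (hlt : ∃ n, 1 ≤ n ∧ a n < m) :
    ∃ n, 1 ≤ n ∧ (∀ k, 1 ≤ k → a n ≤ a k) ∧ ∀ k, n < k → a n < a k := by
  obtain ⟨p, hp1, hp⟩ := hlt
  obtain ⟨N, hN⟩ := eventually_atTop.1 (ha.eventually_const_lt hp)
  have hpN : p < N := by
    by_contra h
    exact lt_irrefl _ (hN p (not_lt.1 h))
  obtain ⟨q, hq, hmin⟩ := Finset.exists_min_image (Finset.Ico 1 N) a ⟨p, by simp; omega⟩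
  obtain ⟨n, hn, hmax⟩ := Finset.exists_max_image
    ((Finset.Ico 1 N).filter fun k => a k = a q) id ⟨q, by simpa using hq⟩
  simp only [Finset.mem_filter, Finset.mem_Ico, id_eq] at hn hmax
  have hall : ∀ k, 1 ≤ k → a n ≤ a k := by
    intro k hk
    rw [hn.2]
    rcases lt_or_ge k N with h | h
    · exact hmin k (by simp; omega)
    · exact (hmin p (by simp; omega)).trans (hN k h).le
  refine ⟨n, hn.1.1, hall, fun k hk => lt_of_le_of_ne (hall k (by omega)) fun h => ?_⟩
  rcases lt_or_ge k N with h' | h'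
  · exact absurd (hmax k ⟨by omega, by rw [← h, hn.2]⟩) (by omega)
  · have h1 := hN k h'
    rw [← h] at h1
    exact absurd (hall p hp1) (not_le.2 h1)

/-- With zero variance all averages equal `m`, so no minimiser is last; this is why `MinAttainedAt`
allows the value `m`. -/
lemma ae_exists_minAttainedAt (m : ℝ) (v : ℝ≥0) :
    ∀ᵐ z ∂stepLaw (gaussianReal m v), ∃ n, MinAttainedAt m z n := by
  rcases eq_or_ne v 0 with rfl | hv
  · rw [stepLaw, gaussianReal_zero_var, Measure.infinitePi_dirac, ae_dirac_eq]
    have h : ∀ n, 1 ≤ n → sampleMean (fun _ => m) n = m := by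
      intro n hn
      have : (n : ℝ) ≠ 0 := by positivity
      simp [sampleMean]
      field_simp
    exact ⟨1, le_rfl, fun k hk => by rw [h 1 le_rfl, h k hk], Or.inl (h 1 le_rfl)⟩
  · filter_upwards [ae_tendsto_sampleMean m v, ae_exists_sampleMean_lt m hv] with z h1 h2
    obtain ⟨n, hn, h3, h4⟩ := exists_last_min h1 h2
    exact ⟨n, hn, h3, Or.inr h4⟩

end RandomWalk

open RandomWalk

/-! ### The greedy procedure on a fixed array of observations -/

section SampleSize

variable {k : ℕ} {s : ℕ → ℕ}

lemma one_le_sampleSize (t i : ℕ) : 1 ≤ sampleSize k s t i := Nat.le_add_right _ _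

@[simp] lemma sampleSize_self (i : ℕ) : sampleSize k s k i = 1 := by simp [sampleSize]

lemma sampleSize_succ {t : ℕ} (ht : k ≤ t) (i : ℕ) :
    sampleSize k s (t + 1) i = sampleSize k s t i + if s t = i then 1 else 0 := by
  rw [sampleSize, ← Finset.insert_Ico_right_eq_Ico_add_one ht, Finset.filter_insert, sampleSize]
  split_ifs with h
  · rw [Finset.card_insert_of_notMem (by simp), add_assoc]
  · rfl

lemma sampleSize_mono (i : ℕ) : Monotone fun t => sampleSize k s t i := fun a b hab => by
  refine Nat.add_le_add_left (Finset.card_le_card ?_) 1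
  exact Finset.filter_subset_filter _ (Finset.Ico_subset_Ico_right hab)

lemma sum_sampleSize {B t : ℕ} (hlt : ∀ u, k ≤ u → u ≤ B → s u < k) (ht : k ≤ t) (htB : t ≤ B) :
    ∑ i ∈ Finset.range k, sampleSize k s t i = t := by
  induction t, ht using Nat.le_induction with
  | base => simp
  | succ t ht ih =>
    simp_rw [sampleSize_succ ht]
    rw [Finset.sum_add_distrib, ih (by omega), Finset.sum_ite_eq,
      if_pos (Finset.mem_range.2 (hlt t ht (by omega)))]

end SampleSize

section Run

variable {k B : ℕ} {x : ℕ → ℕ → ℝ} {s : ℕ → ℕ} {G : Finset ℕ} {L : ℝ}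

/-- Alternatives outside `G` are not observed after they have fallen to the level `L`, if some
alternative always stays above that level. -/
lemma IsGreedyRun.sampleSize_le_hit (hrun : IsGreedyRun k B x s) {i₀ j : ℕ} (hi₀ : i₀ < k)
    (hL : ∀ n, 1 ≤ n → L < sampleMean (x i₀) n)
    (hj : ∃ n, 1 ≤ n ∧ sampleMean (x j) n ≤ L) {t : ℕ} (ht : k ≤ t) (htB : t ≤ B) :
    sampleSize k s t j ≤ hit L (x j) := by
  obtain ⟨h1, h2⟩ := hit_spec hj
  induction t, ht using Nat.le_induction with
  | base => simpa using h1
  | succ t ht ih =>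
    rw [sampleSize_succ ht]
    have ih := ih (by omega)
    split_ifs with hs
    -- Having reached `L`, alternative `j` is beaten by `i₀` and cannot be the one observed.
    · refine Nat.succ_le_of_lt (lt_of_le_of_ne ih fun heq => ?_)
      have h3 := hrun.isMax t ht (by omega) i₀ hi₀
      rw [hs, heq] at h3
      exact absurd (h3.trans h2) (not_le.2 (hL _ (one_le_sampleSize t i₀)))
    · exact ih

/-- If an alternative is observed once more when its running average is at its minimum,
then alternatives outside `G` are not sample-best any more. -/
lemma IsGreedyRun.mem_of_minAttainedAt (hrun : IsGreedyRun k B x s) {i n t : ℕ} {m : ℝ}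
    (hi : i < k) (hmin : MinAttainedAt m (x i) n)
    (hne : ∀ j < k, j ∉ G → ∀ n, 1 ≤ n → sampleMean (x j) n ≠ m)
    (ht : k ≤ t) (hst : s t = i) (hn : sampleSize k s t i = n) {u : ℕ} (htu : t < u)
    (huB : u ≤ B) (hiG : i ∈ G) : s u ∈ G := by
  -- While the alternatives outside `G` are frozen, their averages stay at most the minimum of `i`,
  -- the sample-best value at time `t`. Freezing and selection within `G` then sustain each other by
  -- induction.
  have key : ∀ u, t < u → u ≤ B → (∀ j < k, j ∉ G → sampleSize k s u j = sampleSize k s t j) →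
      s u ∈ G := by
    intro u htu huB hfix
    by_contra hG
    have hlt := hrun.lt u (by omega) huB
    have h1 := hrun.isMax u (by omega) huB i hi
    have h2 := hrun.isMax t ht (by omega) (s u) hlt
    rw [hfix _ hlt hG] at h1
    rw [hst, hn] at h2
    have hnu : n < sampleSize k s u i := by
      have := sampleSize_mono (k := k) (s := s) i (Nat.succ_le_of_lt htu)
      simp only [Nat.succ_eq_add_one, sampleSize_succ ht, hst, hn, if_true] at this
      omega
    have h3 := hmin.2.1 _ (one_le_sampleSize (k := k) (s := s) u i)
    rcases hmin.2.2 with h | h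
    -- The inequalities squeeze the average of `s u` to exactly `m`, a tie excluded by `hne`.
    · exact hne _ hlt hG _ (one_le_sampleSize (k := k) (s := s) t (s u)) (by linarith)
    · exact absurd (h1.trans h2) (not_le.2 (h _ hnu))
  have hfix : ∀ u, t + 1 ≤ u → u ≤ B → ∀ j < k, j ∉ G →
      sampleSize k s u j = sampleSize k s t j := by
    intro u hu
    induction u, hu using Nat.le_induction with
    | base =>
      intro _ j _ hG
      rw [sampleSize_succ ht, if_neg (fun h => hG (by rwa [← h, hst])), add_zero]
    | succ u hu ih =>
      intro huB j hj hG
      have hsu := key u (by omega) (by omega) (ih (by omega))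
      rw [sampleSize_succ (by omega), if_neg (fun h : s u = j => hG (h ▸ hsu)), add_zero,
        ih (by omega) j hj hG]
  exact key u htu huB (hfix u htu huB)

/-- With a sufficiently large budget, the greedy procedure selects an element of `G`. -/
theorem IsGreedyRun.mem_of_lt_budget (hrun : IsGreedyRun k B x s) (μ : ℕ → ℝ) {r : ℕ}
    (hGk : ∀ i ∈ G, i < k) (hmin : ∀ i ∈ G, ∃ n ≤ r, MinAttainedAt (μ i) (x i) n)
    (hhit : ∀ j < k, j ∉ G → ∃ n, 1 ≤ n ∧ sampleMean (x j) n ≤ L)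
    (hne : ∀ j < k, j ∉ G → ∀ i ∈ G, ∀ n, 1 ≤ n → sampleMean (x j) n ≠ μ i)
    (hL : ∃ i ∈ G, ∀ n, 1 ≤ n → L < sampleMean (x i) n)
    (hB : G.card * r + ∑ j ∈ Finset.range k with j ∉ G, hit L (x j) < B) : s B ∈ G := by
  classical
  obtain ⟨i₀, hi₀, hL₀⟩ := hL
  choose! n hnr hn using hmin
  have hsplit : ∀ f : ℕ → ℕ, ∑ i ∈ Finset.range k, f i =
      ∑ i ∈ G, f i + ∑ j ∈ Finset.range k with j ∉ G, f j := by
    intro f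
    rw [← Finset.sum_filter_add_sum_filter_not (Finset.range k) (· ∈ G)]
    congr 2
    ext i
    simp only [Finset.mem_filter, Finset.mem_range]
    exact ⟨fun h => h.2, fun h => ⟨hGk i h, h⟩⟩
  have hbound : ∀ f : ℕ → ℕ, (∀ i ∈ G, f i ≤ r) → (∀ j < k, j ∉ G → f j ≤ hit L (x j)) →
      ∑ i ∈ Finset.range k, f i < B := by
    intro f h1 h2
    rw [hsplit]
    refine lt_of_le_of_lt (add_le_add (Finset.sum_le_card_nsmul G f r h1)
      (Finset.sum_le_sum fun j hj => ?_)) (by simpa using hB)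
    rw [Finset.mem_filter, Finset.mem_range] at hj
    exact h2 j hj.1 hj.2
  -- Sample sizes equal to one satisfy the bounds, so the budget covers the initial round.
  have hkB : k ≤ B := by
    have := hbound (fun _ => 1) (fun i hi => (hn i hi).1.trans (hnr i hi))
      (fun j hj hG => (hit_spec (hhit j hj hG)).1)
    simp at this
    exact this.le
  by_contra hsB
  -- A good alternative observed beyond its minimum would force a good selection. Otherwise the
  -- sample sizes add up to less than `B`, although their sum is `B`.
  have hgood : ∀ i ∈ G, ∀ t, k ≤ t → t ≤ B → sampleSize k s t i ≤ n i := by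
    intro i hi t ht
    induction t, ht using Nat.le_induction with
    | base => intro _; simpa using (hn i hi).1
    | succ t ht ih =>
      intro htB
      rw [sampleSize_succ ht]
      have ih := ih (by omega)
      split_ifs with hs
      · refine Nat.succ_le_of_lt (lt_of_le_of_ne ih fun heq => hsB ?_)
        exact hrun.mem_of_minAttainedAt (hGk i hi) (hn i hi) (fun j hj hG => hne j hj hG i hi) ht hs
          heq (by omega) le_rfl hi
      · exact ih
  have := hbound (sampleSize k s B) (fun i hi => (hgood i hi B hkB le_rfl).trans (hnr i hi))
    (fun j hj hG => hrun.sampleSize_le_hit (hGk i₀ hi₀) hL₀ (hhit j hj hG) hkB le_rfl)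
  rw [sum_sampleSize hrun.lt hkB le_rfl] at this
  exact lt_irrefl _ this

end Run

/-! ### A weak law for the total hitting time -/

section WeakLaw

variable {Ω : Type*} [MeasurableSpace Ω] {P : Measure Ω} [IsProbabilityMeasure P]

/-- An upper weak law of large numbers for independent variables with bounded second moments. -/
theorem tendsto_measure_le_sum {T : ℕ → Ω → ℕ} (J : ℕ → Finset ℕ) (hJ : ∀ k, (J k).card ≤ k)
    (hmeas : ∀ j, AEMeasurable (T j) P) (hind : iIndepFun T P) {C M : ℝ} (hC : 0 ≤ C) (hM : 0 ≤ M)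
    (h1 : ∀ k, ∀ j ∈ J k, ∫⁻ ω, (T j ω : ℝ≥0∞) ∂P ≤ ENNReal.ofReal C)
    (h2 : ∀ k, ∀ j ∈ J k, ∫⁻ ω, (T j ω : ℝ≥0∞) ^ 2 ∂P ≤ ENNReal.ofReal M)
    {d : ℕ → ℝ} {c : ℝ} (hd : Tendsto (fun k => d k / k) atTop (𝓝 c)) (hc : C < c) :
    Tendsto (fun k => P {ω | d k ≤ ∑ j ∈ J k, (T j ω : ℝ)}) atTop (𝓝 0) := by
  set Y : ℕ → Ω → ℝ := fun j ω => (T j ω : ℝ) with hY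
  have hYm : ∀ j, AEMeasurable (Y j) P := fun j =>
    (measurable_from_nat (f := fun n : ℕ => (n : ℝ))).comp_aemeasurable (hmeas j)
  have hYind : iIndepFun Y P := hind.comp (fun _ n => (n : ℝ)) fun _ => measurable_from_nat
  have hLp : ∀ k, ∀ j ∈ J k, MemLp (Y j) 2 P := by
    intro k j hj
    refine ⟨(hYm j).aestronglyMeasurable, ?_⟩
    rw [eLpNorm_lt_top_iff_lintegral_rpow_enorm_lt_top two_ne_zero ENNReal.ofNat_ne_top]
    refine lt_of_le_of_lt (le_of_eq ?_) ((h2 k j hj).trans_lt ENNReal.ofReal_lt_top)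
    refine lintegral_congr fun ω => ?_
    simp [hY]
  have hmean : ∀ k, ∀ j ∈ J k, P[Y j] ≤ C := by
    intro k j hj
    rw [integral_eq_lintegral_of_nonneg_ae (ae_of_all _ fun ω => by simp [hY])
      (hYm j).aestronglyMeasurable]
    refine ENNReal.toReal_le_of_le_ofReal hC ?_
    simpa [hY] using h1 k j hj
  have hvar : ∀ k, ∀ j ∈ J k, Var[Y j; P] ≤ M := by
    intro k j hj
    refine (variance_le_expectation_sq (hYm j).aestronglyMeasurable).trans ?_
    simp only [Pi.pow_apply]
    rw [integral_eq_lintegral_of_nonneg_ae (ae_of_all _ fun ω => by simp [hY])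
      ((hYm j).pow_const 2).aestronglyMeasurable]
    refine ENNReal.toReal_le_of_le_ofReal hM ?_
    refine le_trans (le_of_eq (lintegral_congr fun ω => ?_)) (h2 k j hj)
    simp [hY, ENNReal.ofReal_pow]
  -- Half of the gap absorbs the convergence of `d k / k`; the other half is the deviation used in
  -- Chebyshev's inequality.
  set η := (c - C) / 2 with hη
  have hη0 : 0 < η := by linarith
  have hlim : Tendsto (fun k : ℕ => ENNReal.ofReal (M / η ^ 2 * (1 / (k : ℝ)))) atTop (𝓝 0) := by
    have := (tendsto_one_div_atTop_nhds_zero_nat (𝕜 := ℝ)).const_mul (M / η ^ 2)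
    simpa using ENNReal.tendsto_ofReal this
  refine tendsto_of_tendsto_of_tendsto_of_le_of_le' tendsto_const_nhds hlim
    (Eventually.of_forall fun _ => zero_le) ?_
  filter_upwards [hd.eventually_const_lt (show C + η < c by linarith), eventually_gt_atTop 0]
    with k hk hk0
  have hk0' : (0 : ℝ) < k := by exact_mod_cast hk0
  have hkc : ((J k).card : ℝ) ≤ k := by exact_mod_cast hJ k
  rw [lt_div_iff₀ hk0'] at hk
  have hZ : MemLp (∑ j ∈ J k, Y j) 2 P := memLp_finsetSum' _ (hLp k)
  have hEZ : P[∑ j ∈ J k, Y j] ≤ k * C := by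
    have : P[∑ j ∈ J k, Y j] = ∑ j ∈ J k, P[Y j] := by
      rw [← integral_finsetSum _ fun j hj => (hLp k j hj).integrable one_le_two]
      simp
    rw [this]
    refine (Finset.sum_le_card_nsmul _ _ C (hmean k)).trans ?_
    rw [nsmul_eq_mul]
    gcongr
  have hVZ : Var[∑ j ∈ J k, Y j; P] ≤ k * M := by
    rw [IndepFun.variance_sum (hLp k) fun i _ j _ hij => hYind.indepFun hij]
    refine (Finset.sum_le_card_nsmul _ _ M (hvar k)).trans ?_
    rw [nsmul_eq_mul]
    gcongr
  calc P {ω | d k ≤ ∑ j ∈ J k, (T j ω : ℝ)}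
      ≤ P {ω | η * k ≤ |(∑ j ∈ J k, Y j) ω - P[∑ j ∈ J k, Y j]|} := by
        refine measure_mono fun ω (hω : d k ≤ ∑ j ∈ J k, (T j ω : ℝ)) => ?_
        change η * k ≤ |(∑ j ∈ J k, Y j) ω - P[∑ j ∈ J k, Y j]|
        refine le_trans ?_ (le_abs_self _)
        have hsum : (∑ j ∈ J k, Y j) ω = ∑ j ∈ J k, (T j ω : ℝ) := Finset.sum_apply _ _ _
        rw [hsum]
        nlinarith
    _ ≤ ENNReal.ofReal (Var[∑ j ∈ J k, Y j; P] / (η * k) ^ 2) :=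
        meas_ge_le_variance_div_sq hZ (by positivity)
    _ ≤ ENNReal.ofReal (M / η ^ 2 * (1 / (k : ℝ))) := by
        refine ENNReal.ofReal_le_ofReal ?_
        calc Var[∑ j ∈ J k, Y j; P] / (η * k) ^ 2 ≤ (k * M) / (η * k) ^ 2 := by gcongr
          _ = M / η ^ 2 * (1 / (k : ℝ)) := by field_simp

end WeakLaw

/-! ### From the array of observations to independent walks -/

section Array

variable {Ω : Type*} [MeasurableSpace Ω] {P : Measure Ω}

lemma hasLaw_array {μ : ℕ → ℝ} {σ : ℕ → ℝ≥0} {X : ℕ → ℕ → Ω → ℝ}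
    (hlaw : ∀ i j, HasLaw (X i j) (gaussianReal (μ i) (σ i ^ 2)) P)
    (hindep : iIndepFun (fun p : ℕ × ℕ => X p.1 p.2) P) :
    HasLaw (fun ω i j => X i j ω)
      (Measure.infinitePi fun i => stepLaw (gaussianReal (μ i) (σ i ^ 2))) P := by
  have h := hindep.hasLaw_infinitePi (fun p : ℕ × ℕ => hlaw p.1 p.2)
    (aemeasurable_pi_iff.2 fun p : ℕ × ℕ => (hlaw p.1 p.2).aemeasurable)
  refine ⟨aemeasurable_pi_iff.2 fun i => aemeasurable_pi_iff.2 fun j => (hlaw i j).aemeasurable, ?_⟩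
  rw [← Measure.infinitePi_map_curry, ← h.map_eq,
    AEMeasurable.map_map_of_aemeasurable (by fun_prop) h.aemeasurable]
  rfl

lemma hasLaw_eval {S : Type*} [MeasurableSpace S] {ρ : ℕ → Measure S}
    [∀ i, IsProbabilityMeasure (ρ i)] {W : Ω → ℕ → S}
    (hW : HasLaw W (Measure.infinitePi ρ) P) (i : ℕ) : HasLaw (fun ω => W ω i) (ρ i) P :=
  (measurePreserving_eval_infinitePi ρ i).fun_comp_hasLaw hW

lemma ae_of_hasLaw {S : Type*} [MeasurableSpace S] {ρ : Measure S} {W : Ω → S}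
    (hW : HasLaw W ρ P) {p : S → Prop} (h : ∀ᵐ z ∂ρ, p z) : ∀ᵐ ω ∂P, p (W ω) :=
  ae_of_ae_map hW.aemeasurable (hW.map_eq ▸ h)

end Array

lemma lt_sampleMean_of_lt_runningMin {a : ℝ} {z : ℕ → ℝ} (h : (a : EReal) < runningMin z) {n : ℕ}
    (hn : 1 ≤ n) : a < sampleMean z n := by
  have := h.trans_le (iInf_le _ (n - 1))
  rw [Nat.sub_add_cancel hn] at this
  exact EReal.coe_lt_coe_iff.1 this

/-- Strictness at the infimum leaves room for a higher level, which later makes the mean hitting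
time strictly less than `c`. -/
lemma exists_level {a : ℝ} {z : ℕ → ℝ} (h : (a : EReal) < runningMin z) :
    ∃ N : ℕ, ∀ r ≥ N, ∀ n, 1 ≤ n → a + 1 / ((r : ℝ) + 1) < sampleMean z n := by
  obtain ⟨q, hq1, hq2⟩ := EReal.lt_iff_exists_real_btwn.1 h
  have hq1 : a < q := EReal.coe_lt_coe_iff.1 hq1
  obtain ⟨N, hN⟩ := exists_nat_one_div_lt (sub_pos.2 hq1)
  refine ⟨N, fun r hr n hn => ?_⟩
  have h1 : 1 / ((r : ℝ) + 1) ≤ 1 / ((N : ℝ) + 1) := Nat.one_div_le_one_div hr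
  linarith [lt_sampleMean_of_lt_runningMin hq2 hn]

lemma mem_goodSet {μ : ℕ → ℝ} {δ : ℝ} {k i : ℕ} : i ∈ goodSet μ δ k ↔ i < k ∧ μ 0 - δ < μ i := by
  simp [goodSet]

/-- The good sets increase with `k` and their sizes do not tend to infinity, so there are finitely
many good alternatives in all. -/
lemma exists_eventually_goodSet_eq {μ : ℕ → ℝ} {δ : ℝ}
    (hgood : limsup (fun k : ℕ => ((goodSet μ δ k).card : ℕ∞)) atTop < ⊤) :
    ∃ G : Finset ℕ, (∀ i, i ∈ G ↔ μ 0 - δ < μ i) ∧ ∀ᶠ k in atTop, goodSet μ δ k = G := by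
  obtain ⟨N, hN⟩ := ENat.ne_top_iff_exists.1 hgood.ne
  have hlt : limsup (fun k : ℕ => ((goodSet μ δ k).card : ℕ∞)) atTop < ((N + 1 : ℕ) : ℕ∞) := by
    rw [← hN]
    exact_mod_cast N.lt_succ_self
  have hev := eventually_lt_of_limsup_lt hlt
  have hfin : {i | μ 0 - δ < μ i}.Finite := by
    by_contra hinf
    obtain ⟨t, ht, htc⟩ := Set.Infinite.exists_subset_card_eq hinf (N + 1)
    obtain ⟨K, hK⟩ := t.exists_nat_subset_range
    obtain ⟨k, hk, hkK⟩ := (hev.and (eventually_ge_atTop K)).exists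
    have hsub : t ⊆ goodSet μ δ k := fun i hi =>
      mem_goodSet.2 ⟨(Finset.mem_range.1 (hK hi)).trans_le hkK, ht hi⟩
    have h1 := Finset.card_le_card hsub
    have h2 : (goodSet μ δ k).card < N + 1 := by exact_mod_cast hk
    omega
  refine ⟨hfin.toFinset, fun i => by simp, ?_⟩
  obtain ⟨K, hK⟩ := hfin.toFinset.exists_nat_subset_range
  filter_upwards [eventually_ge_atTop K] with k hk
  ext i
  rw [mem_goodSet, Set.Finite.mem_toFinset]
  refine ⟨fun h => h.2, fun h => ⟨?_, h⟩⟩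
  exact (Finset.mem_range.1 (hK (by simpa using h))).trans_le hk

lemma le_liminf_of_le_add {a : ℝ≥0∞} {u e : ℕ → ℝ≥0∞} (he : Tendsto e atTop (𝓝 0))
    (h : ∀ᶠ k in atTop, a ≤ u k + e k) : a ≤ liminf u atTop := by
  refine le_of_forall_lt fun y hy => ?_
  obtain ⟨y', hy1, hy2⟩ := exists_between hy
  refine hy1.trans_le (le_liminf_of_le (h := ?_))
  filter_upwards [h, he.eventually_lt_const (tsub_pos_of_lt hy2)] with k h1 h2
  by_contra hlt
  push Not at hlt
  have := ENNReal.add_lt_add hlt h2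
  rw [add_tsub_cancel_of_le hy2.le] at this
  exact absurd h1 (not_le.2 this)

/-- The event that some alternative in `G` stays above the level `L`, and that the minima of the
running averages of the alternatives in `G` are attained by time `r`. -/
def goodEvent (μ : ℕ → ℝ) (G : Finset ℕ) (L : ℝ) (r : ℕ) : Set (ℕ → ℕ → ℝ) :=
  {w | (∃ i ∈ G, ∀ n, 1 ≤ n → L < sampleMean (w i) n) ∧
    ∀ i ∈ G, ∃ n ≤ r, MinAttainedAt (μ i) (w i) n}

lemma goodEvent_mono {μ : ℕ → ℝ} {G : Finset ℕ} {L L' : ℝ} {r r' : ℕ} (hL : L' ≤ L) (hr : r ≤ r') :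
    goodEvent μ G L r ⊆ goodEvent μ G L' r' := by
  rintro w ⟨⟨i, hi, h1⟩, h2⟩
  refine ⟨⟨i, hi, fun n hn => hL.trans_lt (h1 n hn)⟩, fun i hi => ?_⟩
  obtain ⟨n, hn, h⟩ := h2 i hi
  exact ⟨n, hn.trans hr, h⟩

/-! ### The probability of good selection -/

section Main

variable {Ω : Type*} [MeasurableSpace Ω] {P : Measure Ω} [IsProbabilityMeasure P]
  {μ : ℕ → ℝ} {σ : ℕ → ℝ≥0} {X : ℕ → ℕ → Ω → ℝ}

/-- For levels below which the walks of the alternatives outside `G` fall quickly enough, the greedy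
procedure selects an element of `G` on `goodEvent` with high probability. -/
lemma measure_goodEvent_le_liminf
    (hlaw : ∀ i j, HasLaw (X i j) (gaussianReal (μ i) (σ i ^ 2)) P)
    (hindep : iIndepFun (fun p : ℕ × ℕ => X p.1 p.2) P)
    {σbar : ℝ} (hσbar : 0 < σbar) (hσ : ∀ i, (σ i : ℝ) ≤ σbar)
    {G : ℕ → Finset ℕ} {G' : Finset ℕ} (hG : ∀ᶠ k in atTop, G k = G')
    {L ε a : ℝ} (hε : 0 < ε) (hgood : ∀ i ∈ G', a < μ i) (hbad : ∀ j ∉ G', μ j ≤ a)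
    (hL : a - L ≤ -ε) {B : ℕ → ℕ} {c : ℝ} (hc : crossingConst (ε / σbar) < c)
    (hB : Tendsto (fun k : ℕ => (B k : ℝ) / (k : ℝ)) atTop (𝓝 c)) {s : ℕ → Ω → ℕ → ℕ}
    (hs : ∀ k, 1 ≤ k → ∀ ω, IsGreedyRun k (B k) (fun i j => X i j ω) (s k ω)) (r : ℕ) :
    P {ω | (fun i j => X i j ω) ∈ goodEvent μ G' L r} ≤
      liminf (fun k : ℕ => P {ω | s k ω (B k) ∈ G k}) atTop := by
  have hW := hasLaw_array hlaw hindep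
  have hWi := hasLaw_eval hW
  have hWind : iIndepFun (fun i ω j => X i j ω) P :=
    (iIndepFun_iff_hasLaw_Pi_infinitePi hWi hW.aemeasurable).2 hW
  set T : ℕ → Ω → ℕ := fun j ω => hit L fun i => X j i ω with hT
  have hTm : ∀ j, AEMeasurable (T j) P := fun j =>
    (measurable_hit L).comp_aemeasurable (hWi j).aemeasurable
  have hTind : iIndepFun T P := hWind.comp (fun _ => hit L) fun _ => measurable_hit L
  set J : ℕ → Finset ℕ := fun k => {j ∈ Finset.range k | j ∉ G'} with hJ
  have hdrift : ∀ j ∉ G', μ j - L ≤ -ε := fun j hj => by linarith [hbad j hj]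
  have hJG : ∀ k, ∀ j ∈ J k, j ∉ G' := fun k j hj => (Finset.mem_filter.1 hj).2
  -- Reserving `r` observations for each good alternative does not change the limiting budget per
  -- alternative.
  have hd : Tendsto (fun k : ℕ => ((B k : ℝ) - G'.card * r) / (k : ℝ)) atTop (𝓝 c) := by
    have := hB.sub (tendsto_const_div_atTop_nhds_zero_nat ((G'.card : ℝ) * r))
    rw [sub_zero] at this
    exact this.congr fun k => (sub_div _ _ _).symm
  have hlim := tendsto_measure_le_sum (T := T) (P := P) J
    (fun k => (Finset.card_filter_le _ _).trans (Finset.card_range k).le) hTm hTind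
    (Real.exp_pos _).le (M := secondMomentBound (ε / σbar))
    (tsum_nonneg fun n => by positivity)
    (fun k j hj => by
      have := (hWi j).lintegral_comp (f := fun z => (hit L z : ℝ≥0∞))
        (measurable_from_nat.comp (measurable_hit L)).aemeasurable
      rw [hT, this]
      exact lintegral_hit_le hε hσbar (hdrift j (hJG k j hj)) (hσ j))
    (fun k j hj => by
      have := (hWi j).lintegral_comp (f := fun z => (hit L z : ℝ≥0∞) ^ 2)
        ((measurable_from_nat (f := fun n : ℕ => (n : ℝ≥0∞) ^ 2)).comp
          (measurable_hit L)).aemeasurable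
      rw [hT, this]
      exact lintegral_hit_sq_le hε hσbar (hdrift j (hJG k j hj)) (hσ j)) hd hc
  have hae : ∀ᵐ ω ∂P, ∀ j ∉ G', (∃ n, 1 ≤ n ∧ sampleMean (fun i => X j i ω) n ≤ L) ∧
      ∀ i ∈ G', ∀ n, 1 ≤ n → sampleMean (fun i => X j i ω) n ≠ μ i := by
    rw [ae_all_iff]
    intro j
    by_cases hj : j ∈ G'
    · exact ae_of_all _ fun ω h => absurd hj h
    · have h1 := ae_of_hasLaw (hWi j) (ae_exists_sampleMean_le hε hσbar (hdrift j hj) (hσ j))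
      have h2 : ∀ᵐ ω ∂P, ∀ i ∈ G', ∀ n, 1 ≤ n → sampleMean (fun i => X j i ω) n ≠ μ i := by
        rw [ae_all_iff]
        intro i
        by_cases hi : i ∈ G'
        · filter_upwards [ae_of_hasLaw (hWi j) (ae_sampleMean_ne (σ j ^ 2)
            ((hbad j hj).trans_lt (hgood i hi)).ne)] with ω h _
          exact h
        · exact ae_of_all _ fun ω h => absurd h hi
      filter_upwards [h1, h2] with ω h1 h2 _
      exact ⟨h1, h2⟩
  refine le_liminf_of_le_add hlim ?_
  obtain ⟨K, hK⟩ := G'.exists_nat_subset_range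
  filter_upwards [hG, eventually_ge_atTop K, eventually_ge_atTop 1] with k hk hkK hk1
  rw [hk]
  refine le_trans (measure_mono_ae ?_) (measure_union_le _ _)
  filter_upwards [hae] with ω hω hev
  by_contra hnot
  rw [Set.union_def] at hnot
  have hnot1 : s k ω (B k) ∉ G' := fun h => hnot (Or.inl h)
  have hnot2 : ∑ j ∈ J k, (T j ω : ℝ) < (B k : ℝ) - G'.card * r :=
    not_le.1 fun h => hnot (Or.inr h)
  refine hnot1 ((hs k hk1 ω).mem_of_lt_budget (L := L) μ (r := r)
    (fun i hi => (Finset.mem_range.1 (hK hi)).trans_le hkK) hev.2 (fun j _ hj => (hω j hj).1)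
    (fun j _ hj => (hω j hj).2) hev.1 ?_)
  have : ((G'.card * r + ∑ j ∈ J k, T j ω : ℕ) : ℝ) < (B k : ℝ) := by
    push_cast
    linarith
  exact_mod_cast this

end Main

theorem proposition1 {Ω : Type*} [MeasurableSpace Ω] (P : Measure Ω) [IsProbabilityMeasure P]
    (μ : ℕ → ℝ) (σ : ℕ → ℝ≥0) (X : ℕ → ℕ → Ω → ℝ)
    (hlaw : ∀ i j, HasLaw (X i j) (gaussianReal (μ i) (σ i ^ 2)) P)
    (hindep : iIndepFun (fun p : ℕ × ℕ => X p.1 p.2) P)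
    (hbest : ∀ i, μ i ≤ μ 0)
    (σbar : ℝ) (hσbar : 0 < σbar) (hσ : ∀ i, (σ i : ℝ) ^ 2 ≤ σbar ^ 2)
    (δ : ℝ) (hδ : 0 < δ)
    (hgood : limsup (fun k : ℕ => ((goodSet μ δ k).card : ℕ∞)) atTop < ⊤)
    (c : ℝ) (hc : crossingConst (δ / σbar) < c)
    (B : ℕ → ℕ) (hB : Tendsto (fun k : ℕ => (B k : ℝ) / (k : ℝ)) atTop (𝓝 c))
    (s : ℕ → Ω → ℕ → ℕ)
    (hs : ∀ k, 1 ≤ k → ∀ ω, IsGreedyRun k (B k) (fun i j => X i j ω) (s k ω)) :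
    (∃ δ₀ ∈ Set.Ioo 0 δ, crossingConst ((δ - δ₀) / σbar) = c) ∧
    ∀ δ₀ ∈ Set.Ioo 0 δ, crossingConst ((δ - δ₀) / σbar) = c →
      limsup (fun k : ℕ => P {ω | ∃ i ∈ goodSet μ δ k,
          ((μ 0 - δ₀ : ℝ) : EReal) < runningMin (fun j => X i j ω)}) atTop
        ≤ liminf (fun k : ℕ => P {ω | s k ω (B k) ∈ goodSet μ δ k}) atTop ∧
      P {ω | ((μ 0 - δ₀ : ℝ) : EReal) < runningMin (fun j => X 0 j ω)}
        ≤ limsup (fun k : ℕ => P {ω | ∃ i ∈ goodSet μ δ k,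
          ((μ 0 - δ₀ : ℝ) : EReal) < runningMin (fun j => X i j ω)}) atTop := by
  have hσ' : ∀ i, (σ i : ℝ) ≤ σbar := fun i => le_of_sq_le_sq (hσ i) hσbar.le
  obtain ⟨G, hG, hGev⟩ := exists_eventually_goodSet_eq hgood
  refine ⟨?_, fun δ₀ hδ₀ hC => ?_⟩
  · obtain ⟨y, hy, hyc⟩ := exists_crossingConst_eq (div_pos hδ hσbar) hc
    have hyδ : y * σbar < δ := (lt_div_iff₀ hσbar).1 hy.2
    have hy0 : 0 < y * σbar := mul_pos hy.1 hσbar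
    refine ⟨δ - y * σbar, ⟨by linarith, by linarith⟩, ?_⟩
    rw [sub_sub_cancel, mul_div_cancel_right₀ _ hσbar.ne']
    exact hyc
  · set A : Set Ω := {ω | ∃ i ∈ G, ((μ 0 - δ₀ : ℝ) : EReal) < runningMin (fun j => X i j ω)}
    have hlimsup : limsup (fun k : ℕ => P {ω | ∃ i ∈ goodSet μ δ k,
        ((μ 0 - δ₀ : ℝ) : EReal) < runningMin (fun j => X i j ω)}) atTop = P A := by
      rw [limsup_congr (v := fun _ => P A) (hGev.mono fun k hk => by rw [hk]), limsup_const]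
    rw [hlimsup]
    refine ⟨?_, measure_mono fun ω hω => ⟨0, (hG 0).2 (by linarith), hω⟩⟩
    -- One parameter `r` both lowers the level to `μ 0 - δ₀` and extends the time allowed for the
    -- minima, so the events `F r` increase.
    set L : ℕ → ℝ := fun r => μ 0 - δ₀ + 1 / ((r : ℝ) + 1) with hL
    set F : ℕ → Set Ω := fun r => {ω | (fun i j => X i j ω) ∈ goodEvent μ G (L r) r} with hF
    have hFmono : Monotone F := fun r r' h ω hω => by
      refine goodEvent_mono ?_ h hω
      have : 1 / ((r' : ℝ) + 1) ≤ 1 / ((r : ℝ) + 1) := Nat.one_div_le_one_div h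
      simp only [hL]
      linarith
    have hAF : P A ≤ P (⋃ r, F r) := by
      have hae : ∀ᵐ ω ∂P, ∀ i, ∃ n, MinAttainedAt (μ i) (fun j => X i j ω) n := by
        rw [ae_all_iff]
        exact fun i => ae_of_hasLaw (hasLaw_eval (hasLaw_array hlaw hindep) i)
          (ae_exists_minAttainedAt (μ i) (σ i ^ 2))
      refine measure_mono_ae ?_
      filter_upwards [hae] with ω hω ⟨i, hi, hlt⟩
      choose n hn using hω
      obtain ⟨N, hN⟩ := exists_level hlt
      refine Set.mem_iUnion.2 ⟨max N (G.sup n), ⟨i, hi, hN _ (le_max_left _ _)⟩, fun i hi => ?_⟩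
      exact ⟨n i, (Finset.le_sup hi).trans (le_max_right _ _), hn i⟩
    refine hAF.trans ?_
    rw [hFmono.measure_iUnion]
    refine iSup_le fun r => ?_
    have hr : (0 : ℝ) < 1 / ((r : ℝ) + 1) := by positivity
    have hδ' : 0 < δ - δ₀ := by linarith [hδ₀.2]
    refine measure_goodEvent_le_liminf hlaw hindep hσbar hσ' hGev
      (ε := δ - δ₀ + 1 / ((r : ℝ) + 1)) (a := μ 0 - δ) (by linarith) (fun i => (hG i).1)
      (fun j hj => not_lt.1 fun h => hj ((hG j).2 h)) (by simp only [hL]; linarith) ?_ hB hs r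
    rw [← hC]
    -- The raised level increases the drift gap beyond `δ - δ₀`, which gives the strict inequality
    -- with `c`.
    refine strictAntiOn_crossingConst (div_pos hδ' hσbar) (div_pos (by linarith) hσbar) ?_
    gcongr
    linarith
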